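/- Let $L>0$, let $\alpha,\beta,\gamma\in\mathbb R$ and let $s>3/2$. Write $w_k=2\pi k/L$ and $\hat f_k=\frac1L\int_0^L f(x)e^{-iw_kx}\,dx$ for $k\in\mathbb Z$, and let $H^s_{per}$ be the space of $L$-periodic $f\in L^2(0,L)$ with $\|f\|_s^2=\sum_{k\in\mathbb Z}(1+k^2)^s|\hat f_k|^2<\infty$. For $\eta>0$ consider the $L$-periodic Cauchy problem $$\partial_t u=\mathcal A u+F(u),\quad u(0)=u_0,\qquad \mathcal A=i\partial_x^2+\eta\partial_x^2+\beta\partial_x^3+\gamma\partial_x,\quad F(u)=-\alpha\,\partial_x(|u|^2u).$$ A solution on $[0,T]$ is a function $u\in C([0,T];H^s_{per})$ with $$u(t)=\mathcal T(t)u_0+\int_0^t\mathcal T(t-\xi)F(u(\xi))\,d\xi\qquad(0\le t\le T),$$ where $\mathcal T(t)$ is the semigroup generated by $\mathcal A$, that is, $\widehat{(\mathcal T(t)f)}_k=e^{(-iw_k^2-\eta w_k^2-i\beta w_k^3+i\gamma w_k)t}\hat f_k$. Then there is a constant $C>0$, independent of $\eta$ and $u_0$ (it may depend on $L,\alpha,\beta,\gamma,s$),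 such that the following holds for all $\eta>0$, all $u_0\in H^s_{per}$ and all $T>0$ with $C\|u_0\|_s^2\,T<2$. There is a solution $u_\eta$ on $[0,T]$; every solution on an interval $[0,T_0]$ with the same initial value $u_0$ coincides with $u_\eta$ on $[0,\min(T_0,T)]$ (so the solution is unique, and any solution on a shorter interval extends to $[0,T]$). The function $t\mapsto\|u_\eta(t)\|_s^2$ is differentiable on $(0,T)$ with $$\frac{d}{dt}\|u_\eta(t)\|_s^2\le C\|u_\eta(t)\|_s^4\qquad(0<t<T),$$ and $$\|u_\eta(t)\|_s^2\le\frac{2\|u_0\|_s^2}{2-Ct\,\|u_0\|_s^2}\qquad(0\le t\le T).$$ -/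

import Mathlib

open MeasureTheory Set Filter Topology

noncomputable section

namespace SchrodingerType

/-- `L²_per(0, L)`: square-integrable complex functions on the circle `ℝ / Lℤ`. The Haar measure
is the Lebesgue measure divided by `L`, so that `fourierCoeff f k` is
`(1 / L) ∫₀ᴸ f(x) exp(-2πikx/L) dx`. -/
abbrev L2per (L : ℝ) [Fact (0 < L)] : Type :=
  Lp ℂ 2 (AddCircle.haarAddCircle (T := L))

/-- The frequency `w_k = 2πk / L`. -/
def freq (L : ℝ) (k : ℤ) : ℝ := 2 * Real.pi * k / L

/-- The Sobolev space `H^s_per`: all `f ∈ L²_per` with `∑_k (1 + k²)^s |f̂_k|² < ∞`. -/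
def Hper (L : ℝ) [Fact (0 < L)] (s : ℝ) : Set (L2per L) :=
  {f | Summable fun k : ℤ => (1 + (k : ℝ) ^ 2) ^ s * ‖fourierCoeff f k‖ ^ 2}

/-- The Sobolev norm `‖f‖_s = (∑_k (1 + k²)^s |f̂_k|²)^{1/2}` (meaningful for `f ∈ H^s_per`). -/
def hnorm {L : ℝ} [Fact (0 < L)] (s : ℝ) (f : L2per L) : ℝ :=
  √(∑' k : ℤ, (1 + (k : ℝ) ^ 2) ^ s * ‖fourierCoeff f k‖ ^ 2)

open Classical in
/-- The Fourier multiplier with symbol `m`: the function in `L²_per` whose `k`-th Fourier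
coefficient is `m k * f̂_k`, for all `f` such that this sequence is square-summable
(and `0` for the other `f`). -/
def multiplier {L : ℝ} [Fact (0 < L)] (m : ℤ → ℂ) (f : L2per L) : L2per L :=
  if h : Memℓp (fun k : ℤ => m k * fourierCoeff f k) 2 then fourierBasis.repr.symm ⟨_, h⟩ else 0

theorem fourierCoeff_multiplier {L : ℝ} [Fact (0 < L)] {m : ℤ → ℂ} {f : L2per L}
    (h : Memℓp (fun k : ℤ => m k * fourierCoeff f k) 2) (k : ℤ) :
    fourierCoeff (multiplier m f) k = m k * fourierCoeff f k := by
  rw [← fourierBasis_repr, multiplier, dif_pos h, LinearIsometryEquiv.apply_symm_apply]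

/-- The derivative `∂_x` on `H^1_per`, i.e. the multiplier with symbol `i w_k`. -/
def dx {L : ℝ} [Fact (0 < L)] (f : L2per L) : L2per L :=
  multiplier (fun k => Complex.I * freq L k) f

open Classical in
/-- The function `|u|² u`, as an element of `L²_per` (`0` if it is not square-integrable, which
does not happen for `u ∈ H^s_per` with `s > 1/2`). -/
def cubic {L : ℝ} [Fact (0 < L)] (u : L2per L) : L2per L :=
  if h : MemLp (fun x => ((‖u x‖ ^ 2 : ℝ) : ℂ) * u x) 2 (AddCircle.haarAddCircle (T := L))
  then h.toLp _ else 0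

/-- The nonlinear term `F(u) = -α ∂_x(|u|² u)`. -/
def nonlin {L : ℝ} [Fact (0 < L)] (α : ℝ) (u : L2per L) : L2per L :=
  -(α : ℂ) • dx (cubic u)

/-- The symbol `-i w_k² - η w_k² - iβ w_k³ + iγ w_k` of
`𝒜 = i∂_x² + η∂_x² + β∂_x³ + γ∂_x`. -/
def symbolA (L η β γ : ℝ) (k : ℤ) : ℂ :=
  -Complex.I * (freq L k) ^ 2 - η * (freq L k) ^ 2 - β * Complex.I * (freq L k) ^ 3
    + Complex.I * γ * freq L k

/-- The semigroup `𝒯(t)` generated by `𝒜` (for `t ≥ 0`). -/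
def semigroup {L : ℝ} [Fact (0 < L)] (η β γ t : ℝ) (f : L2per L) : L2per L :=
  multiplier (fun k => Complex.exp (symbolA L η β γ k * t)) f

theorem norm_exp_symbolA_le {L η β γ t : ℝ} (hη : 0 ≤ η) (ht : 0 ≤ t) (k : ℤ) :
    ‖Complex.exp (symbolA L η β γ k * t)‖ ≤ 1 := by
  rw [Complex.norm_exp, Real.exp_le_one_iff]
  have h : (symbolA L η β γ k * t).re = -(η * freq L k ^ 2 * t) := by
    simp [symbolA, pow_succ, Complex.mul_re, Complex.mul_im]
  rw [h, neg_nonpos]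
  positivity

theorem fourierCoeff_semigroup {L : ℝ} [Fact (0 < L)] {η β γ t : ℝ} (hη : 0 ≤ η) (ht : 0 ≤ t)
    (f : L2per L) (k : ℤ) :
    fourierCoeff (semigroup η β γ t f) k
      = Complex.exp (symbolA L η β γ k * t) * fourierCoeff f k := by
  refine fourierCoeff_multiplier ?_ k
  refine (lp.memℓp (fourierBasis.repr f)).norm.mono fun k => ?_
  rw [norm_mul, fourierBasis_repr]
  exact mul_le_of_le_one_left (norm_nonneg _) (norm_exp_symbolA_le hη ht k)

/-- `u ∈ C([0, T]; H^s_per)`. -/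
structure ContInHper {L : ℝ} [Fact (0 < L)] (s T : ℝ) (u : ℝ → L2per L) : Prop where
  mem : ∀ t ∈ Icc 0 T, u t ∈ Hper L s
  tendsto : ∀ t ∈ Icc 0 T, Tendsto (fun τ => hnorm s (u τ - u t)) (𝓝[Icc 0 T] t) (𝓝 0)

/-- `u ∈ C([0, T]; H^s_per)` is a solution on `[0, T]` of `∂_t u = 𝒜u + F(u)`, `u(0) = u₀`, in the
sense of the integral equation `u(t) = 𝒯(t)u₀ + ∫₀ᵗ 𝒯(t - ξ) F(u(ξ)) dξ`. The integral is the
Bochner integral in `L²_per`. -/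
structure IsSolution {L : ℝ} [Fact (0 < L)] (α β γ η s : ℝ) (u₀ : L2per L) (T : ℝ)
    (u : ℝ → L2per L) : Prop where
  cont : ContInHper s T u
  integrable : ∀ t ∈ Icc 0 T, IntervalIntegrable
    (fun ξ => semigroup η β γ (t - ξ) (nonlin α (u ξ))) volume 0 t
  eq : ∀ t ∈ Icc 0 T, u t = semigroup η β γ t u₀
    + ∫ ξ in (0 : ℝ)..t, semigroup η β γ (t - ξ) (nonlin α (u ξ))

end SchrodingerType

end

/-! Everything is done on Fourier coefficients. With `wt r k = (1 + k²)^(r/2)`, a function in `H^s`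
is identified with the sequence of its coefficients times `wt s`, an element of `ℓ²`, and the
integral equation becomes a family of scalar Duhamel formulas (`mild`), one for each frequency.

Existence uses the dissipation. The symbol `c` of `-α ∂_x` and the symbol `lam` of the generator
satisfy `|c|² ≤ κ (-2 Re lam)`, so Cauchy–Schwarz in time shows that the Duhamel integral absorbs
the derivative in the nonlinearity (`norm_duhamel_sq_le`). Since `H^s` is an algebra
(`summable_wt_conv`), the cubic term composed with the radial retraction onto a ball is globally
Lipschitz (`truncCub`). Some Picard iterate is then a contraction on the whole of `[0, T]`, without
any smallness condition (`existsUnique_mild`). Here `κ` depends on `η`.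

The estimate uniform in `η` comes from a cancellation. In the derivative of `‖u‖_s²` the dissipative
part is nonpositive, and the nonlinear part is the imaginary part of a quartic sum over integers `x
+ y + z + w = 0`, with the odd symbol `osym s k = k (1 + k²)^s` on one of them. The quartic form is
unchanged under exchange of like factors and is conjugated under reflection with a shift, so that
symbol may be replaced by the sum of the four (`tsum_osym_fourth_eq`). The two largest frequencies
nearly cancel: if they are `x` and `y`, then `osym s x + osym s y` is controlled by `|x + y| = |z +
w|` through the mean value theorem. The lost derivative thus falls on the small frequencies
(`quartic_symbol_le`), where it is paid for by a weighted `ℓ¹` norm that is finite because `s > 3/2`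
(`summable_weighted`).

Differentiating the norm term by term is legitimate because solutions are smooth for positive times
(`exists_decay`). Truncation multiplies the cubic term by a real factor in `[0, 1]`, so the energy
inequality `exists_hasDerivAt_norm_sq` holds for the truncated equation with the same constant.
Integrating it (`le_of_deriv_le_sq`) gives a bound below the truncation radius, so the truncation is
never active. Uniqueness follows by truncating at a radius that dominates both solutions
(`eqOn_of_mild`). -/

noncomputable section

namespace SchrodingerType

/-! ### Sobolev weights and the Cauchy–Schwarz inequality for series -/

/-- The weight `(1 + k²)^(r/2)`. -/
def wt (r : ℝ) (k : ℤ) : ℝ := (1 + (k : ℝ) ^ 2) ^ (r / 2)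

theorem wt_pos (r : ℝ) (k : ℤ) : 0 < wt r k := by unfold wt; positivity

theorem one_le_wt {r : ℝ} (hr : 0 ≤ r) (k : ℤ) : 1 ≤ wt r k :=
  Real.one_le_rpow (by nlinarith [sq_nonneg (k : ℝ)]) (by positivity)

theorem wt_add (r t : ℝ) (k : ℤ) : wt (r + t) k = wt r k * wt t k := by
  unfold wt
  rw [← Real.rpow_add (by positivity), add_div]

theorem wt_zero (k : ℤ) : wt 0 k = 1 := by simp [wt]

theorem wt_neg_mul (r : ℝ) (k : ℤ) : wt (-r) k * wt r k = 1 := by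
  rw [← wt_add, neg_add_cancel, wt_zero]

theorem wt_mul_neg (r : ℝ) (k : ℤ) : wt r k * wt (-r) k = 1 := by
  rw [mul_comm, wt_neg_mul]

theorem wt_neg_arg (r : ℝ) (k : ℤ) : wt r (-k) = wt r k := by simp [wt]

theorem wt_mono {r t : ℝ} (h : r ≤ t) (k : ℤ) : wt r k ≤ wt t k :=
  Real.rpow_le_rpow_of_exponent_le (by nlinarith [sq_nonneg (k : ℝ)]) (by linarith)

theorem wt_sq (r : ℝ) (k : ℤ) : wt r k ^ 2 = wt (2 * r) k := by
  rw [two_mul, wt_add, sq]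

theorem wt_two_mul (r : ℝ) (k : ℤ) : wt (2 * r) k = (1 + (k : ℝ) ^ 2) ^ r := by
  unfold wt
  congr 1
  ring

theorem wt_two (k : ℤ) : wt 2 k = 1 + (k : ℝ) ^ 2 := by
  have := wt_two_mul 1 k
  simpa using this

theorem abs_le_wt_one (k : ℤ) : |(k : ℝ)| ≤ wt 1 k := by
  refine abs_le_of_sq_le_sq' ?_ (wt_pos _ _).le |> abs_le.mpr
  rw [wt_sq, mul_one, wt_two]
  linarith

theorem wt_le_wt {r : ℝ} (hr : 0 ≤ r) {p q : ℤ} (h : |(p : ℝ)| ≤ |(q : ℝ)|) : wt r p ≤ wt r q := by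
  refine Real.rpow_le_rpow (by positivity) ?_ (by positivity)
  have := sq_le_sq.mpr h
  linarith

theorem wt_le_pow_mul {r c : ℝ} (hr : 0 ≤ r) (hc : 1 ≤ c) {p q : ℤ}
    (h : |(p : ℝ)| ≤ c * |(q : ℝ)|) : wt r p ≤ c ^ r * wt r q := by
  have h1 : c ^ r = (c ^ 2) ^ (r / 2) := by
    rw [← Real.rpow_natCast, ← Real.rpow_mul (by positivity)]
    congr 1
    push_cast
    ring
  unfold wt
  rw [h1, ← Real.mul_rpow (by positivity) (by positivity)]
  refine Real.rpow_le_rpow (by positivity) ?_ (by positivity)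
  have h2 := pow_le_pow_left₀ (abs_nonneg _) h 2
  rw [mul_pow, sq_abs, sq_abs] at h2
  nlinarith [one_le_pow₀ hc (n := 2)]

/-- The modulus of a sum is at most twice the larger modulus. This is the inequality that makes
weighted spaces stable under convolution. -/
theorem wt_add_arg_le {r : ℝ} (hr : 0 ≤ r) (p q : ℤ) :
    wt r (p + q) ≤ 2 ^ r * (wt r p + wt r q) := by
  have h2 : (0 : ℝ) < 2 ^ r := by positivity
  rcases le_total |(p : ℝ)| |(q : ℝ)| with h | h
  · have : wt r (p + q) ≤ 2 ^ r * wt r q := by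
      refine wt_le_pow_mul hr one_le_two ?_
      push_cast
      linarith [abs_add_le (p : ℝ) q]
    nlinarith [wt_pos r p]
  · have : wt r (p + q) ≤ 2 ^ r * wt r p := by
      refine wt_le_pow_mul hr one_le_two ?_
      push_cast
      linarith [abs_add_le (p : ℝ) q]
    nlinarith [wt_pos r q]

theorem summable_wt {r : ℝ} (hr : r < -1) : Summable (wt r) := by
  have h := Real.summable_abs_int_rpow (b := -r) (by linarith)
  rw [neg_neg] at h
  refine (h.add ((hasSum_ite_eq (0 : ℤ) (1 : ℝ)).summable)).of_nonneg_of_le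
    (fun k => (wt_pos r k).le) fun k => ?_
  split_ifs with hk
  · subst hk
    simp [wt]
    positivity
  · rw [add_zero]
    have hk' : (0 : ℝ) < |(k : ℝ)| := by positivity
    have h1 : |(k : ℝ)| ^ r = ((k : ℝ) ^ 2) ^ (r / 2) := by
      rw [← sq_abs, ← Real.rpow_natCast, ← Real.rpow_mul (abs_nonneg _)]
      congr 1
      push_cast
      ring
    rw [h1, wt]
    exact Real.rpow_le_rpow_of_nonpos (by positivity) (by linarith) (by linarith)

theorem summable_mul_of_sq {ι : Type*} {f g : ι → ℝ} (hf : Summable fun i => f i ^ 2)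
    (hg : Summable fun i => g i ^ 2) : Summable fun i => f i * g i := by
  refine Summable.of_norm_bounded (hf.add hg) fun i => ?_
  rw [Real.norm_eq_abs, abs_mul]
  nlinarith [sq_abs (f i), sq_abs (g i), sq_nonneg (|f i| - |g i|), sq_nonneg (f i),
    sq_nonneg (g i)]

theorem tsum_mul_sq_le {ι : Type*} {f g : ι → ℝ} (hf : Summable fun i => f i ^ 2)
    (hg : Summable fun i => g i ^ 2) :
    (∑' i, f i * g i) ^ 2 ≤ (∑' i, f i ^ 2) * ∑' i, g i ^ 2 := by
  have h := (summable_mul_of_sq hf hg).hasSum.pow 2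
  have h' := Tendsto.mul hf.hasSum hg.hasSum
  refine le_of_tendsto_of_tendsto' h h' fun F => ?_
  exact Finset.sum_mul_sq_le_sq_mul_sq F f g

/-! ### Convolution and the algebra property of `H^s` -/

/-- Convolution of sequences on `ℤ`. -/
def conv (a b : ℤ → ℂ) (k : ℤ) : ℂ := ∑' p, a p * b (k - p)

/-- The Fourier coefficients of the complex conjugate. -/
def refl (a : ℤ → ℂ) (k : ℤ) : ℂ := starRingEnd ℂ (a (-k))

/-- The Fourier coefficients of `|u|² u` in terms of those of `u`. -/
def cub (a : ℤ → ℂ) : ℤ → ℂ := conv (conv a (refl a)) a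

theorem norm_refl (a : ℤ → ℂ) (k : ℤ) : ‖refl a k‖ = ‖a (-k)‖ := by simp [refl]

/-- The constant in the algebra property of `H^s`. -/
def algConst (s : ℝ) : ℝ := 2 ^ (2 * s) * (2 * ∑' k, wt (-(2 * s)) k)

theorem algConst_nonneg (s : ℝ) : 0 ≤ algConst s := by
  have : 0 ≤ ∑' k, wt (-(2 * s)) k := tsum_nonneg fun k => (wt_pos _ k).le
  unfold algConst
  positivity

theorem tsum_sub_left {f : ℤ → ℝ} (k : ℤ) : ∑' p, f (k - p) = ∑' p, f p :=
  (Equiv.subLeft k).tsum_eq f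

theorem summable_sub_left {f : ℤ → ℝ} (hf : Summable f) (k : ℤ) : Summable fun p => f (k - p) :=
  (Equiv.subLeft k).summable_iff.mpr hf

theorem wt_mul_le {s : ℝ} (hs : 0 ≤ s) (k p : ℤ) :
    wt (2 * s) k * (wt (-(2 * s)) p * wt (-(2 * s)) (k - p))
      ≤ 2 ^ (2 * s) * (wt (-(2 * s)) p + wt (-(2 * s)) (k - p)) := by
  have h := wt_add_arg_le (r := 2 * s) (by positivity) p (k - p)
  rw [add_sub_cancel] at h
  have h1 := wt_mul_neg (2 * s) p
  have h2 := wt_mul_neg (2 * s) (k - p)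
  have h3 := mul_le_mul_of_nonneg_right h
    (mul_pos (wt_pos (-(2 * s)) p) (wt_pos (-(2 * s)) (k - p))).le
  refine h3.trans (le_of_eq ?_)
  linear_combination (2 ^ (2 * s) * wt (-(2 * s)) (k - p)) * h1
    + (2 ^ (2 * s) * wt (-(2 * s)) p) * h2

theorem summable_conv_of_sq {a b : ℤ → ℂ} (ha : Summable fun k => ‖a k‖ ^ 2)
    (hb : Summable fun k => ‖b k‖ ^ 2) (k : ℤ) : Summable fun p => a p * b (k - p) := by
  refine Summable.of_norm ?_
  simp_rw [norm_mul]
  exact summable_mul_of_sq ha (summable_sub_left hb k)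

theorem summable_sq_of_wt {s : ℝ} (hs : 0 ≤ s) {a : ℤ → ℂ}
    (ha : Summable fun k => wt (2 * s) k * ‖a k‖ ^ 2) : Summable fun k => ‖a k‖ ^ 2 :=
  ha.of_nonneg_of_le (fun k => by positivity) fun k =>
    le_mul_of_one_le_left (by positivity) (one_le_wt (by positivity) k)

theorem hasSum_conv_mul {f g : ℤ → ℝ} (hf : Summable f) (hg : Summable g)
    (hf0 : 0 ≤ f) (hg0 : 0 ≤ g) :
    HasSum (fun k => ∑' p, f p * g (k - p)) ((∑' k, f k) * ∑' k, g k) := by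
  have h1 : HasSum (fun x : ℤ × ℤ => f x.1 * g x.2) ((∑' k, f k) * ∑' k, g k) :=
    hf.hasSum.mul hg.hasSum (hf.mul_of_nonneg hg hf0 hg0)
  let e : ℤ × ℤ ≃ ℤ × ℤ :=
    { toFun := fun x => (x.2, x.1 - x.2)
      invFun := fun x => (x.1 + x.2, x.1)
      left_inv := fun x => by simp
      right_inv := fun x => by simp }
  have h2 := e.hasSum_iff.mpr h1
  refine h2.prod_fiberwise fun k => (h2.summable.prod_factor k).hasSum

/-- Cauchy–Schwarz after inserting `wt s * wt (-s) = 1` at both arguments. What remains is `wt (2s)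
k` times the convolution of `wt (-2s)` with itself, bounded uniformly in `k` by `wt_mul_le` because
`2s > 1`. -/
theorem wt_mul_norm_conv_sq_le {s : ℝ} (hs : 1 / 2 < s) {a b : ℤ → ℂ}
    (ha : Summable fun k => wt (2 * s) k * ‖a k‖ ^ 2)
    (hb : Summable fun k => wt (2 * s) k * ‖b k‖ ^ 2) (k : ℤ) :
    wt (2 * s) k * ‖conv a b k‖ ^ 2 ≤ algConst s *
      ∑' p, (wt (2 * s) p * ‖a p‖ ^ 2) * (wt (2 * s) (k - p) * ‖b (k - p)‖ ^ 2) := by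
  have hW : Summable (wt (-(2 * s))) := summable_wt (by linarith)
  have hb' : Summable fun p => wt (2 * s) (k - p) * ‖b (k - p)‖ ^ 2 := summable_sub_left hb k
  have hab : Summable fun p => (wt s p * ‖a p‖ * (wt s (k - p) * ‖b (k - p)‖)) ^ 2 := by
    have h0 := (hasSum_conv_mul ha hb (fun k => by have := wt_pos (2*s) k; positivity)
      (fun k => by have := wt_pos (2*s) k; positivity))
    have : Summable fun p => wt (2 * s) p * ‖a p‖ ^ 2 * (wt (2 * s) (k - p) * ‖b (k - p)‖ ^ 2) := by
      refine (hb'.mul_left (∑' p, wt (2 * s) p * ‖a p‖ ^ 2)).of_nonneg_of_le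
        (fun p => by have := wt_pos (2*s) p; have := wt_pos (2*s) (k-p); positivity) fun p => ?_
      refine mul_le_mul_of_nonneg_right ?_ (by have := wt_pos (2*s) (k-p); positivity)
      exact ha.le_tsum p fun j _ => by have := wt_pos (2*s) j; positivity
    refine this.congr fun p => ?_
    rw [← wt_sq, ← wt_sq]
    ring
  have hw : Summable fun p => (wt (-s) p * wt (-s) (k - p)) ^ 2 := by
    refine hW.of_nonneg_of_le (fun p => by positivity) fun p => ?_
    rw [mul_pow, wt_sq, wt_sq, mul_neg]
    refine mul_le_of_le_one_right (wt_pos _ _).le ?_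
    rw [← wt_zero (k - p)]
    exact wt_mono (by linarith) _
  have h1 : ‖conv a b k‖ ≤ ∑' p, (wt s p * ‖a p‖ * (wt s (k - p) * ‖b (k - p)‖))
      * (wt (-s) p * wt (-s) (k - p)) := by
    have e : ∀ p, (wt s p * ‖a p‖ * (wt s (k - p) * ‖b (k - p)‖))
      * (wt (-s) p * wt (-s) (k - p)) = ‖a p * b (k - p)‖ := fun p => by
      rw [norm_mul]
      linear_combination (‖a p‖ * ‖b (k - p)‖ * (wt s (k - p) * wt (-s) (k - p))) * wt_mul_neg s p
        + ‖a p‖ * ‖b (k - p)‖ * wt_mul_neg s (k - p)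
    simp_rw [e]
    refine norm_tsum_le_tsum_norm ?_
    exact (summable_mul_of_sq hab hw).congr e
  have h2 := tsum_mul_sq_le hab hw
  have h3 : wt (2 * s) k * ∑' p, (wt (-s) p * wt (-s) (k - p)) ^ 2 ≤ algConst s := by
    rw [← tsum_mul_left]
    have h4 : Summable fun p => 2 ^ (2 * s) * (wt (-(2 * s)) p + wt (-(2 * s)) (k - p)) :=
      (hW.add (summable_sub_left hW k)).mul_left _
    refine (Summable.tsum_le_tsum (fun p => ?_) (hw.mul_left _) h4).trans (le_of_eq ?_)
    · rw [mul_pow, wt_sq, wt_sq, mul_neg]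
      exact wt_mul_le (by linarith) k p
    · rw [tsum_mul_left, (hW.tsum_add (summable_sub_left hW k)), tsum_sub_left, algConst, two_mul]
      simp [two_mul]
  have h5 : ∑' p, (wt s p * ‖a p‖ * (wt s (k - p) * ‖b (k - p)‖)) ^ 2 =
      ∑' p, (wt (2 * s) p * ‖a p‖ ^ 2) * (wt (2 * s) (k - p) * ‖b (k - p)‖ ^ 2) := by
    refine tsum_congr fun p => ?_
    rw [← wt_sq, ← wt_sq]
    ring
  rw [← h5]
  have h6 : 0 ≤ ∑' p, (wt s p * ‖a p‖ * (wt s (k - p) * ‖b (k - p)‖)) ^ 2 :=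
    tsum_nonneg fun p => by positivity
  calc wt (2 * s) k * ‖conv a b k‖ ^ 2
      ≤ wt (2 * s) k * ((∑' p, (wt s p * ‖a p‖ * (wt s (k - p) * ‖b (k - p)‖)) ^ 2) *
          ∑' p, (wt (-s) p * wt (-s) (k - p)) ^ 2) := by
        refine mul_le_mul_of_nonneg_left ?_ (wt_pos _ _).le
        exact (pow_le_pow_left₀ (norm_nonneg _) h1 2).trans h2
    _ = (wt (2 * s) k * ∑' p, (wt (-s) p * wt (-s) (k - p)) ^ 2) *
          ∑' p, (wt s p * ‖a p‖ * (wt s (k - p) * ‖b (k - p)‖)) ^ 2 := by ring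
    _ ≤ _ := mul_le_mul_of_nonneg_right h3 h6

theorem summable_wt_conv {s : ℝ} (hs : 1 / 2 < s) {a b : ℤ → ℂ}
    (ha : Summable fun k => wt (2 * s) k * ‖a k‖ ^ 2)
    (hb : Summable fun k => wt (2 * s) k * ‖b k‖ ^ 2) :
    Summable (fun k => wt (2 * s) k * ‖conv a b k‖ ^ 2) ∧
    ∑' k, wt (2 * s) k * ‖conv a b k‖ ^ 2 ≤ algConst s *
      ((∑' k, wt (2 * s) k * ‖a k‖ ^ 2) * ∑' k, wt (2 * s) k * ‖b k‖ ^ 2) := by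
  have h := (hasSum_conv_mul ha hb (fun k => by have := wt_pos (2*s) k; positivity)
      (fun k => by have := wt_pos (2*s) k; positivity)).mul_left (algConst s)
  have hle := wt_mul_norm_conv_sq_le hs ha hb
  have h1 : Summable (fun k => wt (2 * s) k * ‖conv a b k‖ ^ 2) :=
    h.summable.of_nonneg_of_le (fun k => by have := wt_pos (2*s) k; positivity) hle
  refine ⟨h1, ?_⟩
  rw [← h.tsum_eq]
  exact h1.tsum_le_tsum hle h.summable

/-- Pointwise counterpart of the algebra property: one of the two arguments is comparable to `k` and
yields the weight, while the other is summed. It carries the decay through the cubic term in the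
smoothing argument. -/
theorem norm_conv_le_wt {r : ℝ} (hr : 1 < r) {a b : ℤ → ℂ} {A B : ℝ}
    (ha : ∀ k, ‖a k‖ ≤ A * wt (-r) k) (hb : ∀ k, ‖b k‖ ≤ B * wt (-r) k) (k : ℤ) :
    ‖conv a b k‖ ≤ A * B * (2 ^ r * (2 * ∑' k, wt (-r) k)) * wt (-r) k := by
  have hW : Summable (wt (-r)) := summable_wt (by linarith)
  have hA : 0 ≤ A := nonneg_of_mul_nonneg_left ((norm_nonneg _).trans (ha 0)) (wt_pos _ _)
  have hB : 0 ≤ B := nonneg_of_mul_nonneg_left ((norm_nonneg _).trans (hb 0)) (wt_pos _ _)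
  have h4 := ((hW.add (summable_sub_left hW k)).mul_left (A * B * 2 ^ r * wt (-r) k))
  have hle : ∀ p, ‖a p * b (k - p)‖ ≤
      A * B * 2 ^ r * wt (-r) k * (wt (-r) p + wt (-r) (k - p)) := fun p => by
    rw [norm_mul]
    have h1 := mul_le_mul (ha p) (hb (k - p)) (norm_nonneg _) (mul_nonneg hA (wt_pos _ _).le)
    refine h1.trans ?_
    have h2 := wt_mul_le (s := r / 2) (by linarith) k p
    rw [mul_div_cancel₀ r two_ne_zero] at h2
    have h3 := mul_le_mul_of_nonneg_left h2 (wt_pos (-r) k).le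
    rw [← mul_assoc, wt_neg_mul, one_mul] at h3
    nlinarith [mul_le_mul_of_nonneg_left h3 (mul_nonneg hA hB)]
  refine (tsum_of_norm_bounded h4.hasSum hle).trans (le_of_eq ?_)
  rw [tsum_mul_left, hW.tsum_add (summable_sub_left hW k), tsum_sub_left]
  ring

theorem norm_cub_le_wt {r : ℝ} (hr : 1 < r) {a : ℤ → ℂ} {A : ℝ}
    (ha : ∀ k, ‖a k‖ ≤ A * wt (-r) k) (k : ℤ) :
    ‖cub a k‖ ≤ A ^ 3 * (2 ^ r * (2 * ∑' k, wt (-r) k)) ^ 2 * wt (-r) k := by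
  have hb : ∀ k, ‖refl a k‖ ≤ A * wt (-r) k := fun k => by
    rw [norm_refl, ← wt_neg_arg]
    exact ha _
  refine (norm_conv_le_wt hr (norm_conv_le_wt hr ha hb) ha k).trans (le_of_eq ?_)
  ring

/-! ### The symmetrised quartic symbol -/

/-- The odd symbol `k (1 + k²)^s`. -/
def osym (s : ℝ) (k : ℤ) : ℝ := k * wt (2 * s) k

theorem osym_neg (s : ℝ) (k : ℤ) : osym s (-k) = -osym s k := by
  simp [osym, wt_neg_arg]

/-- Mean value inequality for `w (1 + w²)^s` on `[-|z|, |z|]`, whose derivative is at most `(1 + 2s)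
(1 + w²)^s` there. -/
theorem abs_osym_sub_le {s : ℝ} (hs : 0 ≤ s) {x y z : ℤ} (hx : |(x : ℝ)| ≤ |(z : ℝ)|)
    (hy : |(y : ℝ)| ≤ |(z : ℝ)|) :
    |osym s x - osym s y| ≤ (1 + 2 * s) * wt (2 * s) z * |(x : ℝ) - y| := by
  have hd : ∀ w ∈ Icc (-|(z : ℝ)|) |(z : ℝ)|,
      HasDerivWithinAt (fun w : ℝ => w * (1 + w ^ 2) ^ s)
        (1 * (1 + w ^ 2) ^ s + w * (((2 : ℕ) * w ^ (2 - 1) * 1) * s * (1 + w ^ 2) ^ (s - 1)))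
        (Icc (-|(z : ℝ)|) |(z : ℝ)|) w := fun w _ => by
    have h1 : HasDerivAt (fun w : ℝ => 1 + w ^ 2) ((2 : ℕ) * w ^ (2 - 1) * 1) w :=
      ((hasDerivAt_id w).pow 2).const_add 1
    have h2 := h1.rpow_const (p := s) (Or.inl (by positivity))
    exact ((hasDerivAt_id w).mul h2).hasDerivWithinAt
  have hb : ∀ w ∈ Icc (-|(z : ℝ)|) |(z : ℝ)|,
      ‖1 * (1 + w ^ 2) ^ s + w * (((2 : ℕ) * w ^ (2 - 1) * 1) * s * (1 + w ^ 2) ^ (s - 1))‖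
        ≤ (1 + 2 * s) * wt (2 * s) z := fun w hw => by
    have h0 : (0 : ℝ) < 1 + w ^ 2 := by positivity
    have e : (1 + w ^ 2) ^ s = (1 + w ^ 2) ^ (s - 1) * (1 + w ^ 2) := by
      rw [← Real.rpow_add_one h0.ne', sub_add_cancel]
    have h1 : (1 + w ^ 2) ^ s ≤ wt (2 * s) z := by
      rw [wt_two_mul]
      refine Real.rpow_le_rpow h0.le ?_ hs
      have := sq_le_sq.mpr ((abs_le.mpr hw).trans (le_abs_self |(z : ℝ)|))
      rw [sq_abs] at this
      linarith
    have h2 : 0 < (1 + w ^ 2) ^ (s - 1) := by positivity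
    have h4 : 0 ≤ w * (((2 : ℕ) * w ^ (2 - 1) * 1) * s * (1 + w ^ 2) ^ (s - 1)) := by
      rw [show w * (((2 : ℕ) * w ^ (2 - 1) * 1) * s * (1 + w ^ 2) ^ (s - 1)) =
        2 * w ^ 2 * s * (1 + w ^ 2) ^ (s - 1) by push_cast; simp only [pow_one]; ring]
      positivity
    rw [Real.norm_of_nonneg (by positivity)]
    push_cast
    simp only [pow_one]
    have h3 : w * (2 * w * 1 * s * (1 + w ^ 2) ^ (s - 1)) ≤ 2 * s * (1 + w ^ 2) ^ s := by
      rw [e]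
      nlinarith [mul_nonneg hs h2.le]
    nlinarith
  have h := Convex.norm_image_sub_le_of_norm_hasDerivWithin_le hd hb (convex_Icc _ _)
    (abs_le.mp hy) (abs_le.mp hx)
  simpa [osym, wt_two_mul] using h

/-- The constant in the bound for the symmetrised quartic symbol. -/
def quarticConst (s : ℝ) : ℝ := 2 * (1 + 2 * s) * 3 ^ s + 2

theorem quarticConst_pos {s : ℝ} (hs : 0 ≤ s) : 0 < quarticConst s := by
  unfold quarticConst
  positivity

theorem abs_osym_le {s : ℝ} (hs : 0 ≤ s) {x y z : ℤ} (h1 : |(z : ℝ)| ≤ |(x : ℝ)|)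
    (h2 : |(z : ℝ)| ≤ |(y : ℝ)|) : |osym s z| ≤ wt s x * wt s y * wt 1 z := by
  rw [osym, abs_mul, abs_of_pos (wt_pos _ _), two_mul, wt_add]
  have := mul_le_mul (wt_le_wt hs h1) (wt_le_wt hs h2) (wt_pos _ _).le (wt_pos _ _).le
  rw [mul_comm]
  exact mul_le_mul this (abs_le_wt_one z) (abs_nonneg _)
    (mul_pos (wt_pos _ _) (wt_pos _ _)).le

/-- Since `osym` is odd, the sum is the difference between `x` and `-y`, so one full derivative is
exchanged for `|x + y|`. Comparability of `x` and `y` distributes `wt (2s) y` over both. -/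
theorem abs_osym_add_le {s : ℝ} (hs : 0 ≤ s) {x y : ℤ} {w : ℝ}
    (h1 : |(x : ℝ)| ≤ |(y : ℝ)|) (h2 : |(y : ℝ)| ≤ 3 * |(x : ℝ)|) (h3 : |(x : ℝ) + y| ≤ 2 * w) :
    |osym s x + osym s y| ≤ 2 * (1 + 2 * s) * 3 ^ s * (wt s x * wt s y * w) := by
  have h := abs_osym_sub_le hs (x := x) (y := -y) (z := y) h1 (by simp)
  rw [osym_neg, sub_neg_eq_add] at h
  push_cast at h
  rw [sub_neg_eq_add] at h
  have h4 : wt (2 * s) y ≤ 3 ^ s * wt s x * wt s y := by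
    rw [two_mul, wt_add]
    exact mul_le_mul_of_nonneg_right (wt_le_pow_mul hs (by norm_num) h2) (wt_pos _ _).le
  have h5 := mul_le_mul h4 h3 (abs_nonneg _)
    (by have := wt_pos s x; have := wt_pos s y; positivity)
  have h6 := mul_le_mul_of_nonneg_left h5 (by linarith : 0 ≤ 1 + 2 * s)
  linarith

/-- The heart of the energy estimate. The zero sum gives `x + y = -(z + w)` and makes the two
dominant frequencies comparable within a factor 3, so their symbols cancel up to `|z + w|`. The
symbols of `z` and `w` are estimated directly and account for the `+ 2` in `quarticConst`. -/
theorem quartic_symbol_le {s : ℝ} (hs : 0 ≤ s) {x y z w : ℤ} (h0 : x + y + z + w = 0)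
    (h1 : |(z : ℝ)| ≤ |(x : ℝ)|) (h2 : |(z : ℝ)| ≤ |(y : ℝ)|) (h3 : |(w : ℝ)| ≤ |(x : ℝ)|)
    (h4 : |(w : ℝ)| ≤ |(y : ℝ)|) :
    |osym s x + osym s y + osym s z + osym s w|
      ≤ quarticConst s * (wt s x * wt s y * (wt 1 z * wt 1 w)) := by
  have h0' : (x : ℝ) + y + z + w = 0 := by exact_mod_cast h0
  have hz := one_le_wt zero_le_one z
  have hw := one_le_wt zero_le_one w
  have hz' := abs_le_wt_one z
  have hw' := abs_le_wt_one w
  have hzw : |(z : ℝ) + w| ≤ 2 * (wt 1 z * wt 1 w) := by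
    refine (abs_add_le _ _).trans ?_
    nlinarith
  have hxy : |(x : ℝ) + y| = |(z : ℝ) + w| := by
    rw [← abs_neg]
    congr 1
    linarith
  have hA := abs_add_le (z : ℝ) w
  have hsum : |osym s x + osym s y| ≤
      2 * (1 + 2 * s) * 3 ^ s * (wt s x * wt s y * (wt 1 z * wt 1 w)) := by
    rcases le_total |(x : ℝ)| |(y : ℝ)| with h | h
    · refine abs_osym_add_le hs h ?_ (hxy ▸ hzw)
      have := abs_sub_abs_le_abs_sub (y : ℝ) (-x)
      rw [abs_neg, sub_neg_eq_add, add_comm (y : ℝ)] at this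
      linarith
    · rw [add_comm, mul_comm (wt s x)]
      rw [add_comm] at hxy
      refine abs_osym_add_le hs h ?_ (hxy ▸ hzw)
      have := abs_sub_abs_le_abs_sub (x : ℝ) (-y)
      rw [abs_neg, sub_neg_eq_add, add_comm (x : ℝ)] at this
      linarith
  have hp := mul_pos (wt_pos s x) (wt_pos s y)
  have hz2 : |osym s z| ≤ wt s x * wt s y * (wt 1 z * wt 1 w) :=
    (abs_osym_le hs h1 h2).trans
      (mul_le_mul_of_nonneg_left (le_mul_of_one_le_right (wt_pos _ _).le hw) hp.le)
  have hw2 : |osym s w| ≤ wt s x * wt s y * (wt 1 z * wt 1 w) :=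
    (abs_osym_le hs h3 h4).trans
      (mul_le_mul_of_nonneg_left (le_mul_of_one_le_left (wt_pos _ _).le hz) hp.le)
  have := abs_add_le (osym s x + osym s y + osym s z) (osym s w)
  have := abs_add_le (osym s x + osym s y) (osym s z)
  unfold quarticConst
  linarith

theorem exists_pair_le (a b c d : ℝ) :
    (c ≤ a ∧ c ≤ b ∧ d ≤ a ∧ d ≤ b) ∨ (b ≤ a ∧ b ≤ c ∧ d ≤ a ∧ d ≤ c) ∨
    (b ≤ a ∧ b ≤ d ∧ c ≤ a ∧ c ≤ d) ∨ (a ≤ b ∧ a ≤ c ∧ d ≤ b ∧ d ≤ c) ∨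
    (a ≤ b ∧ a ≤ d ∧ c ≤ b ∧ c ≤ d) ∨ (a ≤ c ∧ a ≤ d ∧ b ≤ c ∧ b ≤ d) := by
  rcases le_total a b with h1 | h1 <;> rcases le_total a c with h2 | h2 <;>
  rcases le_total a d with h3 | h3 <;> rcases le_total b c with h4 | h4 <;>
  rcases le_total b d with h5 | h5 <;> rcases le_total c d with h6 | h6 <;> grind

/-- Pointwise bound for the quartic form; `P` and `D` are the densities of the `H^s` norm and of
the weighted `ℓ¹` norm. -/
theorem quartic_term_le {s : ℝ} (hs : 0 ≤ s) {x y z w : ℤ} (h0 : x + y + z + w = 0)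
    {a b c d : ℝ} (ha : 0 ≤ a) (hb : 0 ≤ b) (hc : 0 ≤ c) (hd : 0 ≤ d)
    {Pa Pb Pc Pd Da Db Dc Dd : ℝ}
    (ePa : Pa = wt (2 * s) x * a ^ 2) (ePb : Pb = wt (2 * s) y * b ^ 2)
    (ePc : Pc = wt (2 * s) z * c ^ 2) (ePd : Pd = wt (2 * s) w * d ^ 2)
    (eDa : Da = wt 1 x * a) (eDb : Db = wt 1 y * b) (eDc : Dc = wt 1 z * c)
    (eDd : Dd = wt 1 w * d) :
    |osym s x + osym s y + osym s z + osym s w| * (a * b * c * d) ≤ quarticConst s / 2 *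
      ((Pa * Db * Dc + Pa * Db * Dd + Pa * Dc * Dd) + (Pb * Da * Dc + Pb * Da * Dd + Pb * Dc * Dd)
        + (Pc * Da * Db + Pc * Da * Dd + Pc * Db * Dd)
        + (Pd * Da * Db + Pd * Da * Dc + Pd * Db * Dc)) := by
  have hC := quarticConst_pos hs
  have hPa : 0 ≤ Pa := by rw [ePa]; have := wt_pos (2 * s) x; positivity
  have hPb : 0 ≤ Pb := by rw [ePb]; have := wt_pos (2 * s) y; positivity
  have hPc : 0 ≤ Pc := by rw [ePc]; have := wt_pos (2 * s) z; positivity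
  have hPd : 0 ≤ Pd := by rw [ePd]; have := wt_pos (2 * s) w; positivity
  have hDa : 0 ≤ Da := by rw [eDa]; have := wt_pos 1 x; positivity
  have hDb : 0 ≤ Db := by rw [eDb]; have := wt_pos 1 y; positivity
  have hDc : 0 ≤ Dc := by rw [eDc]; have := wt_pos 1 z; positivity
  have hDd : 0 ≤ Dd := by rw [eDd]; have := wt_pos 1 w; positivity
  -- The product of the two dominant factors is split by `2pq ≤ p² + q²`, which produces the factor
  -- `1 / 2`.
  have key : ∀ {x y z w : ℤ} {a b c d M : ℝ}, 0 ≤ c → 0 ≤ d → 0 ≤ a → 0 ≤ b →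
      M ≤ quarticConst s * (wt s x * wt s y * (wt 1 z * wt 1 w)) →
      M * (a * b * c * d) ≤ quarticConst s / 2 * ((wt (2 * s) x * a ^ 2 + wt (2 * s) y * b ^ 2) *
        ((wt 1 z * c) * (wt 1 w * d))) := by
    intro x y z w a b c d M hc hd ha hb hM
    refine (mul_le_mul_of_nonneg_right hM (by positivity)).trans ?_
    rw [← wt_sq, ← wt_sq]
    have h1 : 0 ≤ (wt 1 z * c) * (wt 1 w * d) := by
      have := wt_pos 1 z
      have := wt_pos 1 w
      positivity
    have h2 := mul_nonneg (mul_nonneg hC.le (sq_nonneg (wt s x * a - wt s y * b))) h1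
    nlinarith
  have n1 := fun {p q r : ℝ} (hp : 0 ≤ p) (hq : 0 ≤ q) (hr : 0 ≤ r) =>
    mul_nonneg (mul_nonneg hp hq) hr
  have l1 := n1 hPa hDb hDc
  have l2 := n1 hPa hDb hDd
  have l3 := n1 hPa hDc hDd
  have l4 := n1 hPb hDa hDc
  have l5 := n1 hPb hDa hDd
  have l6 := n1 hPb hDc hDd
  have l7 := n1 hPc hDa hDb
  have l8 := n1 hPc hDa hDd
  have l9 := n1 hPc hDb hDd
  have l10 := n1 hPd hDa hDb
  have l11 := n1 hPd hDa hDc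
  have l12 := n1 hPd hDb hDc
  have fin : ∀ {A B : ℝ}, A ≤ B → quarticConst s / 2 * A ≤ quarticConst s / 2 * B :=
    fun h => mul_le_mul_of_nonneg_left h (by positivity)
  -- One case for each choice of the dominant pair. Only two of the twelve nonnegative terms are
  -- needed each time; the full sum avoids splitting the index set.
  rcases exists_pair_le |(x : ℝ)| |(y : ℝ)| |(z : ℝ)| |(w : ℝ)| with
    ⟨h1, h2, h3, h4⟩ | ⟨h1, h2, h3, h4⟩ | ⟨h1, h2, h3, h4⟩ | ⟨h1, h2, h3, h4⟩ | ⟨h1, h2, h3, h4⟩ |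
    ⟨h1, h2, h3, h4⟩
  · have := key hc hd ha hb (quartic_symbol_le hs h0 h1 h2 h3 h4)
    rw [← ePa, ← ePb, ← eDc, ← eDd] at this
    exact this.trans (fin (by linarith))
  · have := key hb hd ha hc (quartic_symbol_le hs (by omega : x + z + y + w = 0) h1 h2 h3 h4)
    rw [← ePa, ← ePc, ← eDb, ← eDd] at this
    rw [show osym s x + osym s y + osym s z + osym s w = osym s x + osym s z + osym s y + osym s w
      by ring, show a * b * c * d = a * c * b * d by ring]
    exact this.trans (fin (by linarith))
  · have := key hb hc ha hd (quartic_symbol_le hs (by omega : x + w + y + z = 0) h1 h2 h3 h4)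
    rw [← ePa, ← ePd, ← eDb, ← eDc] at this
    rw [show osym s x + osym s y + osym s z + osym s w = osym s x + osym s w + osym s y + osym s z
      by ring, show a * b * c * d = a * d * b * c by ring]
    exact this.trans (fin (by linarith))
  · have := key ha hd hb hc (quartic_symbol_le hs (by omega : y + z + x + w = 0) h1 h2 h3 h4)
    rw [← ePb, ← ePc, ← eDa, ← eDd] at this
    rw [show osym s x + osym s y + osym s z + osym s w = osym s y + osym s z + osym s x + osym s w
      by ring, show a * b * c * d = b * c * a * d by ring]
    exact this.trans (fin (by linarith))
  · have := key ha hc hb hd (quartic_symbol_le hs (by omega : y + w + x + z = 0) h1 h2 h3 h4)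
    rw [← ePb, ← ePd, ← eDa, ← eDc] at this
    rw [show osym s x + osym s y + osym s z + osym s w = osym s y + osym s w + osym s x + osym s z
      by ring, show a * b * c * d = b * d * a * c by ring]
    exact this.trans (fin (by linarith))
  · have := key ha hb hc hd (quartic_symbol_le hs (by omega : z + w + x + y = 0) h1 h2 h3 h4)
    rw [← ePc, ← ePd, ← eDa, ← eDb] at this
    rw [show osym s x + osym s y + osym s z + osym s w = osym s z + osym s w + osym s x + osym s y
      by ring, show a * b * c * d = c * d * a * b by ring]
    exact this.trans (fin (by linarith))

/-! ### Sums over quadruples with zero sum and the symmetries of the quartic form -/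

/-- The fourth index of a quadruple of integers with zero sum. -/
def fourth (x : ℤ × ℤ × ℤ) : ℤ := -(x.1 + x.2.1 + x.2.2)

/-- Exchange of the first and the fourth index. -/
def swapFst : ℤ × ℤ × ℤ ≃ ℤ × ℤ × ℤ where
  toFun x := (fourth x, x.2.1, x.2.2)
  invFun x := (fourth x, x.2.1, x.2.2)
  left_inv x := by ext <;> dsimp only [fourth] <;> ring
  right_inv x := by ext <;> dsimp only [fourth] <;> ring

/-- Exchange of the second and the fourth index. -/
def swapSnd : ℤ × ℤ × ℤ ≃ ℤ × ℤ × ℤ where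
  toFun x := (x.1, fourth x, x.2.2)
  invFun x := (x.1, fourth x, x.2.2)
  left_inv x := by ext <;> dsimp only [fourth] <;> ring
  right_inv x := by ext <;> dsimp only [fourth] <;> ring

/-- Exchange of the third and the fourth index. -/
def swapTrd : ℤ × ℤ × ℤ ≃ ℤ × ℤ × ℤ where
  toFun x := (x.1, x.2.1, fourth x)
  invFun x := (x.1, x.2.1, fourth x)
  left_inv x := by ext <;> dsimp only [fourth] <;> ring
  right_inv x := by ext <;> dsimp only [fourth] <;> ring

theorem hasSum_triple {f g h : ℤ → ℝ} {a b c : ℝ} (hf : HasSum f a) (hg : HasSum g b)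
    (hh : HasSum h c) (hf0 : 0 ≤ f) (hg0 : 0 ≤ g) (hh0 : 0 ≤ h) :
    HasSum (fun x : ℤ × ℤ × ℤ => f x.1 * g x.2.1 * h x.2.2) (a * b * c) := by
  have h1 := hg.mul hh (hg.summable.mul_of_nonneg hh.summable hg0 hh0)
  have h2 := hf.mul h1 (hf.summable.mul_of_nonneg h1.summable hf0
    fun x => mul_nonneg (hg0 _) (hh0 _))
  simpa only [mul_assoc] using h2

theorem hasSum_triple_fst {f g h : ℤ → ℝ} {a b c : ℝ} (hf : HasSum f a) (hg : HasSum g b)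
    (hh : HasSum h c) (hf0 : 0 ≤ f) (hg0 : 0 ≤ g) (hh0 : 0 ≤ h) :
    HasSum (fun x : ℤ × ℤ × ℤ => f (fourth x) * g x.2.1 * h x.2.2) (a * b * c) :=
  swapFst.hasSum_iff.mpr (hasSum_triple hf hg hh hf0 hg0 hh0)

theorem hasSum_triple_snd {f g h : ℤ → ℝ} {a b c : ℝ} (hf : HasSum f a) (hg : HasSum g b)
    (hh : HasSum h c) (hf0 : 0 ≤ f) (hg0 : 0 ≤ g) (hh0 : 0 ≤ h) :
    HasSum (fun x : ℤ × ℤ × ℤ => f (fourth x) * g x.1 * h x.2.2) (a * b * c) := by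
  have := swapSnd.hasSum_iff.mpr (hasSum_triple hg hf hh hg0 hf0 hh0)
  rw [mul_comm b a] at this
  refine this.congr_fun fun x => ?_
  simp only [swapSnd, Function.comp, Equiv.coe_fn_mk]
  ring

theorem hasSum_triple_trd {f g h : ℤ → ℝ} {a b c : ℝ} (hf : HasSum f a) (hg : HasSum g b)
    (hh : HasSum h c) (hf0 : 0 ≤ f) (hg0 : 0 ≤ g) (hh0 : 0 ≤ h) :
    HasSum (fun x : ℤ × ℤ × ℤ => f (fourth x) * g x.1 * h x.2.1) (a * b * c) := by
  have := swapTrd.hasSum_iff.mpr (hasSum_triple hg hh hf hg0 hh0 hf0)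
  rw [show b * c * a = a * b * c by ring] at this
  refine this.congr_fun fun x => ?_
  simp only [swapTrd, Function.comp, Equiv.coe_fn_mk]
  ring

/-- The summand of the quartic form `∫ |u|⁴`. -/
def quarticTerm (v : ℤ → ℂ) (x : ℤ × ℤ × ℤ) : ℂ :=
  v x.1 * refl v x.2.1 * v x.2.2 * refl v (fourth x)

theorem fourth_swapSnd (x : ℤ × ℤ × ℤ) : fourth (swapSnd x) = x.2.1 := by
  simp only [swapSnd, fourth, Equiv.coe_fn_mk]; ring

theorem quarticTerm_swapSnd (v : ℤ → ℂ) (x : ℤ × ℤ × ℤ) :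
    quarticTerm v (swapSnd x) = quarticTerm v x := by
  simp only [quarticTerm, fourth_swapSnd]
  simp only [swapSnd, Equiv.coe_fn_mk]
  ring

/-- Exchange of the first and the third index. -/
def swapFstTrd : ℤ × ℤ × ℤ ≃ ℤ × ℤ × ℤ where
  toFun x := (x.2.2, x.2.1, x.1)
  invFun x := (x.2.2, x.2.1, x.1)
  left_inv _ := rfl
  right_inv _ := rfl

theorem fourth_swapFstTrd (x : ℤ × ℤ × ℤ) : fourth (swapFstTrd x) = fourth x := by
  simp only [swapFstTrd, fourth, Equiv.coe_fn_mk]; ring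

theorem quarticTerm_swapFstTrd (v : ℤ → ℂ) (x : ℤ × ℤ × ℤ) :
    quarticTerm v (swapFstTrd x) = quarticTerm v x := by
  simp only [quarticTerm, fourth_swapFstTrd]
  simp only [swapFstTrd, Equiv.coe_fn_mk]
  ring

/-- Cyclic shift of the four indices combined with a reflection. -/
def shiftNeg : ℤ × ℤ × ℤ ≃ ℤ × ℤ × ℤ where
  toFun x := (-x.2.1, -x.2.2, -fourth x)
  invFun y := (-fourth y, -y.1, -y.2.1)
  left_inv x := by ext <;> dsimp only [fourth] <;> ring
  right_inv x := by ext <;> dsimp only [fourth] <;> ring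

theorem fourth_shiftNeg (x : ℤ × ℤ × ℤ) : fourth (shiftNeg x) = -x.1 := by
  simp only [shiftNeg, fourth, Equiv.coe_fn_mk]; ring

theorem quarticTerm_shiftNeg (v : ℤ → ℂ) (x : ℤ × ℤ × ℤ) :
    quarticTerm v (shiftNeg x) = starRingEnd ℂ (quarticTerm v x) := by
  simp only [quarticTerm, fourth_shiftNeg, refl, neg_neg, map_mul, Complex.conj_conj]
  simp only [shiftNeg, neg_neg, Equiv.coe_fn_mk]
  ring

theorem norm_quarticTerm (v : ℤ → ℂ) (x : ℤ × ℤ × ℤ) :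
    ‖quarticTerm v x‖ = ‖v x.1‖ * ‖v (-x.2.1)‖ * ‖v x.2.2‖ * ‖v (-fourth x)‖ := by
  simp [quarticTerm, norm_refl]

theorem hasSum_neg_arg {f : ℤ → ℝ} {a : ℝ} (h : HasSum f a) : HasSum (fun k => f (-k)) a :=
  (Equiv.neg ℤ).hasSum_iff.mpr h

theorem summable_osym_fst {s : ℝ} {v : ℤ → ℂ} (h1 : Summable fun k => ‖v k‖)
    (h2 : Summable fun k => |osym s k| * ‖v k‖) :
    Summable fun x : ℤ × ℤ × ℤ => (osym s x.1 : ℂ) * quarticTerm v x := by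
  have h3 := hasSum_triple h2.hasSum (hasSum_neg_arg h1.hasSum) h1.hasSum
    (fun k => by positivity) (fun k => by positivity) (fun k => by positivity)
  refine Summable.of_norm_bounded (h3.summable.mul_left (∑' k, ‖v k‖)) fun x => ?_
  have h4 : ‖v (-fourth x)‖ ≤ ∑' k, ‖v k‖ := h1.le_tsum _ fun j _ => norm_nonneg _
  rw [norm_mul, norm_quarticTerm, Complex.norm_real, Real.norm_eq_abs]
  have := mul_le_mul_of_nonneg_right h4
    (by positivity : 0 ≤ |osym s x.1| * ‖v x.1‖ * ‖v (-x.2.1)‖ * ‖v x.2.2‖)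
  linarith

theorem summable_osym_fourth {s : ℝ} {v : ℤ → ℂ} (h1 : Summable fun k => ‖v k‖)
    (h2 : Summable fun k => |osym s k| * ‖v k‖) :
    Summable fun x : ℤ × ℤ × ℤ => (osym s (fourth x) : ℂ) * quarticTerm v x := by
  refine (shiftNeg.summable_iff (f := fun x => (osym s (fourth x) : ℂ) * quarticTerm v x)).mp ?_
  refine ((Complex.summable_conj.mpr (summable_osym_fst h1 h2)).neg).congr fun x => ?_
  simp [fourth_shiftNeg, quarticTerm_shiftNeg, osym_neg]

/-- Cauchy–Schwarz for `wt 1 = wt (1 - s) * wt s`. The condition `s > 3/2` is what makes `wt (1 -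
s)` square-summable. -/
theorem summable_weighted {s : ℝ} (hs : 3 / 2 < s) {v : ℤ → ℂ}
    (hv : Summable fun k => wt (2 * s) k * ‖v k‖ ^ 2) :
    Summable (fun k => wt 1 k * ‖v k‖) ∧ (∑' k, wt 1 k * ‖v k‖) ^ 2 ≤
      (∑' k, wt (-(2 * (s - 1))) k) * ∑' k, wt (2 * s) k * ‖v k‖ ^ 2 := by
  have h1 : Summable fun k => (wt (1 - s) k) ^ 2 := by
    simp_rw [wt_sq]
    exact summable_wt (by linarith)
  have h2 : Summable fun k => (wt s k * ‖v k‖) ^ 2 := by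
    simp_rw [mul_pow, wt_sq]
    exact hv
  have e : ∀ k, wt (1 - s) k * (wt s k * ‖v k‖) = wt 1 k * ‖v k‖ := fun k => by
    rw [← mul_assoc, ← wt_add, sub_add_cancel]
  have h3 := summable_mul_of_sq h1 h2
  have h4 := tsum_mul_sq_le h1 h2
  simp_rw [e] at h3 h4
  simp_rw [mul_pow, wt_sq] at h4
  rw [show 2 * (1 - s) = -(2 * (s - 1)) by ring] at h4
  exact ⟨h3, h4⟩

theorem norm_tsum_osym_le {s : ℝ} (hs : 3 / 2 < s) {v : ℤ → ℂ}
    (hv : Summable fun k => wt (2 * s) k * ‖v k‖ ^ 2) :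
    ‖∑' x : ℤ × ℤ × ℤ, ((osym s x.1 + osym s x.2.1 + osym s x.2.2 + osym s (fourth x) : ℝ) : ℂ)
        * quarticTerm v x‖
      ≤ 6 * quarticConst s * (∑' k, wt (-(2 * (s - 1))) k) *
        (∑' k, wt (2 * s) k * ‖v k‖ ^ 2) ^ 2 := by
  obtain ⟨hD, hD2⟩ := summable_weighted hs hv
  set y := ∑' k, wt (2 * s) k * ‖v k‖ ^ 2
  set d := ∑' k, wt 1 k * ‖v k‖
  let P : ℤ → ℝ := fun k => wt (2 * s) k * ‖v k‖ ^ 2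
  let D : ℤ → ℝ := fun k => wt 1 k * ‖v k‖
  have hP0 : 0 ≤ P := fun k => by have := wt_pos (2 * s) k; simp only [P, Pi.zero_apply]; positivity
  have hD0 : 0 ≤ D := fun k => by have := wt_pos 1 k; simp only [D, Pi.zero_apply]; positivity
  let P' : ℤ → ℝ := fun k => P (-k)
  let D' : ℤ → ℝ := fun k => D (-k)
  have hP0' : 0 ≤ P' := fun k => hP0 (-k)
  have hD0' : 0 ≤ D' := fun k => hD0 (-k)
  have sP : HasSum P y := hv.hasSum
  have sD : HasSum D d := hD.hasSum
  have sP' : HasSum P' y := hasSum_neg_arg sP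
  have sD' : HasSum D' d := hasSum_neg_arg sD
  -- Each of the twelve products omits one of the four indices, so the other three range freely and
  -- the sum factorises as `y * d * d`. The primed densities belong to the second and fourth
  -- positions, where `quarticTerm` evaluates `v` at the negated index.
  have H := (((((hasSum_triple sP sD' sD hP0 hD0' hD0).add
      (hasSum_triple_trd sD' sP sD' hD0' hP0 hD0')).add
      (hasSum_triple_snd sD' sP sD hD0' hP0 hD0)).add
    (((hasSum_triple sD sP' sD hD0 hP0' hD0).add
      (hasSum_triple_trd sD' sD sP' hD0' hD0 hP0')).add
      (hasSum_triple_fst sD' sP' sD hD0' hP0' hD0))).add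
    (((hasSum_triple sD sD' sP hD0 hD0' hP0).add
      (hasSum_triple_snd sD' sD sP hD0' hD0 hP0)).add
      (hasSum_triple_fst sD' sD' sP hD0' hD0' hP0))).add
    (((hasSum_triple_trd sP' sD sD' hP0' hD0 hD0').add
      (hasSum_triple_snd sP' sD sD hP0' hD0 hD0)).add
      (hasSum_triple_fst sP' sD' sD hP0' hD0' hD0))
  have H' := H.mul_left (quarticConst s / 2)
  refine (tsum_of_norm_bounded H' fun x => ?_).trans ?_
  · rw [norm_mul, norm_quarticTerm, Complex.norm_real, Real.norm_eq_abs]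
    have h0 : x.1 + x.2.1 + x.2.2 + fourth x = 0 := by simp [fourth]
    refine (quartic_term_le (Pa := P x.1) (Pb := P' x.2.1) (Pc := P x.2.2) (Pd := P' (fourth x))
      (Da := D x.1) (Db := D' x.2.1) (Dc := D x.2.2) (Dd := D' (fourth x))
      (by linarith) h0 (norm_nonneg _) (norm_nonneg _) (norm_nonneg _)
      (norm_nonneg _) rfl ?_ rfl ?_ rfl ?_ rfl ?_).trans (le_of_eq ?_)
    · simp [P', P, wt_neg_arg]
    · simp [P', P, wt_neg_arg]
    · simp [D', D, wt_neg_arg]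
    · simp [D', D, wt_neg_arg]
    · ring
  · have hC := quarticConst_pos (s := s) (by linarith)
    have hy : 0 ≤ y := tsum_nonneg hP0
    have := mul_le_mul_of_nonneg_left hD2 (mul_nonneg (by positivity : 0 ≤ 6 * quarticConst s) hy)
    linarith

/-- Let `S` be the sum with the symbol at the fourth index. Exchange of the second and fourth index
gives `S` again. The shift with reflection conjugates the form and changes the sign of the odd
symbol, so the first index gives `-conj S`, and so does the third by exchange with the first. The
total is `2 (S - conj S)`. -/
theorem tsum_osym_fourth_eq {s : ℝ} {v : ℤ → ℂ} (h1 : Summable fun k => ‖v k‖)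
    (h2 : Summable fun k => |osym s k| * ‖v k‖) :
    4 * Complex.I * ((∑' x : ℤ × ℤ × ℤ, (osym s (fourth x) : ℂ) * quarticTerm v x).im : ℂ) =
    ∑' x : ℤ × ℤ × ℤ, ((osym s x.1 + osym s x.2.1 + osym s x.2.2 + osym s (fourth x) : ℝ) : ℂ)
        * quarticTerm v x := by
  have s1 := summable_osym_fst h1 h2
  have s4 := summable_osym_fourth h1 h2
  have e2 : (fun x : ℤ × ℤ × ℤ => (osym s x.2.1 : ℂ) * quarticTerm v x) =
      (fun x : ℤ × ℤ × ℤ => (osym s (fourth x) : ℂ) * quarticTerm v x) ∘ swapSnd := by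
    funext x
    simp [fourth_swapSnd, quarticTerm_swapSnd]
  have e3 : (fun x : ℤ × ℤ × ℤ => (osym s x.2.2 : ℂ) * quarticTerm v x) =
      (fun x : ℤ × ℤ × ℤ => (osym s x.1 : ℂ) * quarticTerm v x) ∘ swapFstTrd := by
    funext x
    simp only [Function.comp, quarticTerm_swapFstTrd]
    rfl
  have s2 : Summable fun x : ℤ × ℤ × ℤ => (osym s x.2.1 : ℂ) * quarticTerm v x := by
    rw [e2]; exact swapSnd.summable_iff.mpr s4
  have s3 : Summable fun x : ℤ × ℤ × ℤ => (osym s x.2.2 : ℂ) * quarticTerm v x := by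
    rw [e3]; exact swapFstTrd.summable_iff.mpr s1
  have t2 : ∑' x : ℤ × ℤ × ℤ, (osym s x.2.1 : ℂ) * quarticTerm v x =
      ∑' x, (osym s (fourth x) : ℂ) * quarticTerm v x := by
    rw [e2]; exact swapSnd.tsum_eq fun x => (osym s (fourth x) : ℂ) * quarticTerm v x
  have t3 : ∑' x : ℤ × ℤ × ℤ, (osym s x.2.2 : ℂ) * quarticTerm v x =
      ∑' x : ℤ × ℤ × ℤ, (osym s x.1 : ℂ) * quarticTerm v x := by
    rw [e3]; exact swapFstTrd.tsum_eq fun x : ℤ × ℤ × ℤ => (osym s x.1 : ℂ) * quarticTerm v x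
  have t1 : ∑' x : ℤ × ℤ × ℤ, (osym s x.1 : ℂ) * quarticTerm v x =
      -starRingEnd ℂ (∑' x, (osym s (fourth x) : ℂ) * quarticTerm v x) := by
    rw [← shiftNeg.tsum_eq fun x => (osym s (fourth x) : ℂ) * quarticTerm v x, Complex.conj_tsum,
      ← tsum_neg]
    refine tsum_congr fun x => ?_
    simp [fourth_shiftNeg, quarticTerm_shiftNeg, osym_neg]
  simp_rw [Complex.ofReal_add, add_mul]
  rw [((s1.add s2).add s3).tsum_add s4, (s1.add s2).tsum_add s3, s1.tsum_add s2, t2, t3, t1]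
  set S := ∑' x, (osym s (fourth x) : ℂ) * quarticTerm v x
  have := Complex.sub_conj S
  push_cast at this
  linear_combination (-2) * this

/-- Change of variables from the iterated convolution to quadruples with zero sum. -/
def convIdx : ℤ × ℤ × ℤ ≃ ℤ × ℤ × ℤ where
  toFun y := (y.2.2, y.2.1 - y.2.2, y.1 - y.2.1)
  invFun x := (x.1 + x.2.1 + x.2.2, x.1 + x.2.1, x.1)
  left_inv x := by ext <;> simp
  right_inv x := by ext <;> simp

theorem fourth_convIdx (x : ℤ × ℤ × ℤ) : fourth (convIdx x) = -x.1 := by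
  simp [convIdx, fourth]

/-- Unfolding the two convolutions gives the indices `p`, `q - p`, `k - q` and, from the conjugated
factor, `-k`, which sum to zero. The minus sign comes from `osym s (-k) = -osym s k`. -/
theorem hasSum_osym_cub {s : ℝ} {v : ℤ → ℂ} (h1 : Summable fun k => ‖v k‖)
    (h2 : Summable fun k => |osym s k| * ‖v k‖) :
    HasSum (fun k => (osym s k : ℂ) * (cub v k * starRingEnd ℂ (v k)))
      (-∑' x : ℤ × ℤ × ℤ, (osym s (fourth x) : ℂ) * quarticTerm v x) := by
  have s4 := summable_osym_fourth h1 h2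
  have h3 := (convIdx.hasSum_iff.mpr s4.hasSum).neg
  have h4 := h3.prod_fiberwise fun k => (h3.summable.prod_factor k).hasSum
  refine h4.congr_fun fun k => ?_
  have h5 := h3.summable.prod_factor k
  rw [h5.tsum_prod, cub, conv, ← tsum_mul_right, ← tsum_mul_left]
  refine tsum_congr fun q => ?_
  rw [conv, ← tsum_mul_right, ← tsum_mul_right, ← tsum_mul_left]
  refine tsum_congr fun p => ?_
  simp only [Function.comp, fourth_convIdx, osym_neg, quarticTerm, refl, neg_neg]
  simp only [convIdx, Equiv.coe_fn_mk]
  push_cast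
  ring

/-- The constant in the energy estimate. -/
def energyConst (s : ℝ) : ℝ := 3 / 2 * quarticConst s * (∑' k, wt (-(2 * (s - 1))) k)

theorem energyConst_nonneg {s : ℝ} (hs : 0 ≤ s) : 0 ≤ energyConst s := by
  have := quarticConst_pos hs
  have : 0 ≤ ∑' k, wt (-(2 * (s - 1))) k := tsum_nonneg fun k => (wt_pos _ _).le
  unfold energyConst
  positivity

/-- `h1` and `h2` only justify rearranging the series; the bound itself involves nothing beyond the
`H^s` norm. -/
theorem abs_tsum_osym_cub_le {s : ℝ} (hs : 3 / 2 < s) {v : ℤ → ℂ}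
    (h1 : Summable fun k => ‖v k‖) (h2 : Summable fun k => |osym s k| * ‖v k‖)
    (hv : Summable fun k => wt (2 * s) k * ‖v k‖ ^ 2) :
    |∑' k, osym s k * (cub v k * starRingEnd ℂ (v k)).im|
      ≤ energyConst s * (∑' k, wt (2 * s) k * ‖v k‖ ^ 2) ^ 2 := by
  have h3 := Complex.hasSum_im (hasSum_osym_cub h1 h2)
  simp_rw [Complex.im_ofReal_mul] at h3
  rw [h3.tsum_eq, Complex.neg_im, abs_neg]
  have h4 := norm_tsum_osym_le hs hv
  rw [← tsum_osym_fourth_eq h1 h2, norm_mul, norm_mul, Complex.norm_I, Complex.norm_real,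
    Real.norm_eq_abs] at h4
  unfold energyConst
  norm_num at h4 ⊢
  linarith

/-! ### Dominated convergence in `ℓ²` and the Duhamel integral -/

/-- Square-summable sequences on `ℤ`. -/
abbrev SeqL2 : Type := lp (fun _ : ℤ => ℂ) 2

theorem memℓp_two_iff {f : ℤ → ℂ} : Memℓp f 2 ↔ Summable fun k => ‖f k‖ ^ 2 := by
  rw [memℓp_gen_iff (by norm_num)]
  simp

theorem SeqL2.hasSum_sq (f : SeqL2) : HasSum (fun k => ‖f k‖ ^ 2) (‖f‖ ^ 2) := by
  have := lp.hasSum_norm (p := 2) (by norm_num) f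
  simpa using this

theorem SeqL2.norm_apply_le (f : SeqL2) (k : ℤ) : ‖f k‖ ≤ ‖f‖ :=
  lp.norm_apply_le_norm two_ne_zero f k

theorem SeqL2.continuous_apply (k : ℤ) : Continuous fun f : SeqL2 => f k :=
  LipschitzWith.continuous (K := 1) <| LipschitzWith.of_dist_le_mul fun f g => by
    rw [dist_eq_norm, dist_eq_norm, NNReal.coe_one, one_mul]
    exact SeqL2.norm_apply_le (f - g) k

theorem SeqL2.tendsto_of_dominated {α : Type*} {l : Filter α} {f : α → SeqL2} {a : SeqL2}
    {B : ℤ → ℝ} (hB : Summable B) (hf : ∀ k, Tendsto (fun x => f x k) l (𝓝 (a k)))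
    (hfB : ∀ᶠ x in l, ∀ k, ‖f x k‖ ^ 2 ≤ B k) (haB : ∀ k, ‖a k‖ ^ 2 ≤ B k) :
    Tendsto f l (𝓝 a) := by
  rw [tendsto_iff_norm_sub_tendsto_zero]
  have h1 : Tendsto (fun x => ∑' k, ‖(f x - a) k‖ ^ 2) l (𝓝 (∑' _ : ℤ, (0 : ℝ))) := by
    refine tendsto_tsum_of_dominated_convergence (hB.mul_left 4) (fun k => ?_) ?_
    · have := ((hf k).sub_const (a k)).norm.pow 2
      simpa using this
    · filter_upwards [hfB] with x hx k
      rw [Real.norm_of_nonneg (by positivity)]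
      have h2 : ‖(f x - a) k‖ ≤ ‖f x k‖ + ‖a k‖ := norm_sub_le _ _
      have h3 := pow_le_pow_left₀ (norm_nonneg _) h2 2
      nlinarith [hx k, haB k, sq_nonneg (‖f x k‖ - ‖a k‖)]
  rw [tsum_zero] at h1
  have h2 := h1.sqrt
  rw [Real.sqrt_zero] at h2
  refine h2.congr fun x => ?_
  rw [(SeqL2.hasSum_sq _).tsum_eq, Real.sqrt_sq (norm_nonneg _)]

theorem sq_integral_mul_le {f g : ℝ → ℝ} (hf : Continuous f) (hg : Continuous g) {t : ℝ}
    (ht : 0 ≤ t) : (∫ x in (0 : ℝ)..t, f x * g x) ^ 2 ≤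
      (∫ x in (0 : ℝ)..t, f x ^ 2) * ∫ x in (0 : ℝ)..t, g x ^ 2 := by
  have h : ∀ y : ℝ, 0 ≤ (∫ x in (0 : ℝ)..t, f x ^ 2) * (y * y)
      + (2 * ∫ x in (0 : ℝ)..t, f x * g x) * y + ∫ x in (0 : ℝ)..t, g x ^ 2 := fun y => by
    have h1 : 0 ≤ ∫ x in (0 : ℝ)..t, (f x ^ 2 * (y * y) + f x * g x * (2 * y) + g x ^ 2) := by
      refine intervalIntegral.integral_nonneg ht fun x _ => ?_
      nlinarith [sq_nonneg (f x * y + g x)]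
    rw [intervalIntegral.integral_add, intervalIntegral.integral_add,
      intervalIntegral.integral_mul_const, intervalIntegral.integral_mul_const] at h1
    · linarith
    all_goals exact Continuous.intervalIntegrable (by fun_prop) _ _
  have := discrim_le_zero h
  rw [discrim] at this
  nlinarith

/-- The Duhamel integral `∫₀ᵗ exp((t - ξ) lam) c g(ξ) dξ` in Fourier space. -/
def duhamel (lam c : ℤ → ℂ) (g : ℝ → SeqL2) (t : ℝ) (k : ℤ) : ℂ :=
  ∫ ξ in (0 : ℝ)..t, Complex.exp (lam k * (t - ξ : ℝ)) * (c k * g ξ k)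

section
variable {lam c : ℤ → ℂ} {κ : ℝ} {g : ℝ → SeqL2}

theorem continuous_duhamel_integrand (hg : Continuous g) (t : ℝ) (k : ℤ) :
    Continuous fun ξ : ℝ => Complex.exp (lam k * (t - ξ : ℝ)) * (c k * g ξ k) := by
  have := (SeqL2.continuous_apply k).comp hg
  simp only [Function.comp_def] at this
  fun_prop

theorem duhamel_sub {h : ℝ → SeqL2} (hg : Continuous g) (hh : Continuous h) (t : ℝ) (k : ℤ) :
    duhamel lam c (fun ξ => g ξ - h ξ) t k = duhamel lam c g t k - duhamel lam c h t k := by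
  unfold duhamel
  rw [← intervalIntegral.integral_sub
    ((continuous_duhamel_integrand hg t k).intervalIntegrable _ _)
    ((continuous_duhamel_integrand hh t k).intervalIntegrable _ _)]
  refine intervalIntegral.integral_congr fun ξ _ => ?_
  simp only [lp.coeFn_sub, Pi.sub_apply]
  ring

theorem duhamel_eq_exp_mul (t : ℝ) (k : ℤ) :
    duhamel lam c g t k = Complex.exp (lam k * t) *
      ∫ ξ in (0 : ℝ)..t, Complex.exp (-(lam k * ξ)) * (c k * g ξ k) := by
  rw [duhamel, ← intervalIntegral.integral_const_mul]
  refine intervalIntegral.integral_congr fun ξ _ => ?_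
  have h : Complex.exp (lam k * (t - ξ : ℝ)) =
      Complex.exp (lam k * t) * Complex.exp (-(lam k * ξ)) := by
    rw [← Complex.exp_add]
    congr 1
    push_cast
    ring
  simp only [h, mul_assoc]

theorem hasDerivAt_duhamel (hg : Continuous g) (t : ℝ) (k : ℤ) :
    HasDerivAt (fun t => duhamel lam c g t k) (lam k * duhamel lam c g t k + c k * g t k) t := by
  have h0 : Continuous fun ξ : ℝ => Complex.exp (-(lam k * ξ)) * (c k * g ξ k) := by
    have := (SeqL2.continuous_apply k).comp hg
    simp only [Function.comp_def] at this
    fun_prop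
  have h1 := intervalIntegral.integral_hasDerivAt_right (h0.intervalIntegrable 0 t)
    h0.aestronglyMeasurable.stronglyMeasurableAtFilter h0.continuousAt
  have h2 : HasDerivAt (fun t : ℝ => Complex.exp (lam k * t))
      (Complex.exp (lam k * t) * (lam k * 1)) t :=
    ((hasDerivAt_id t).ofReal_comp.const_mul (lam k)).cexp
  have h3 := h2.mul h1
  simp_rw [duhamel_eq_exp_mul]
  refine h3.congr_deriv ?_
  have h4 : Complex.exp (lam k * t) * Complex.exp (-(lam k * t)) = 1 := by
    rw [← Complex.exp_add, add_neg_cancel, Complex.exp_zero]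
  linear_combination (c k * g t k) * h4

theorem continuous_duhamel (hg : Continuous g) (k : ℤ) :
    Continuous fun t => duhamel lam c g t k :=
  continuous_iff_continuousAt.mpr fun t => (hasDerivAt_duhamel hg t k).continuousAt

theorem norm_exp_mul_real (z : ℂ) (t : ℝ) : ‖Complex.exp (z * t)‖ = Real.exp (z.re * t) := by
  rw [Complex.norm_exp]
  simp

theorem mul_integral_exp_le (r t : ℝ) :
    (-r) * ∫ ξ in (0 : ℝ)..t, Real.exp (r * (t - ξ)) ≤ 1 := by
  have h : ∀ ξ ∈ uIcc 0 t, HasDerivAt (fun ξ => Real.exp (r * (t - ξ)))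
      ((-r) * Real.exp (r * (t - ξ))) ξ := fun ξ _ => by
    have := (((hasDerivAt_id ξ).const_sub t).const_mul r).exp
    refine this.congr_deriv ?_
    simp
    ring
  rw [← intervalIntegral.integral_const_mul, intervalIntegral.integral_eq_sub_of_hasDerivAt h
    (Continuous.intervalIntegrable (by fun_prop) _ _)]
  simp [Real.exp_nonneg]

/-- Cauchy–Schwarz in time leaves `|c|² ∫ exp (2 Re lam (t - ξ))`, and `-2 Re lam` times this
integral is at most 1. The derivative encoded in `c` is thereby absorbed at the cost of an `L²` norm
in time. -/
theorem norm_duhamel_sq_le (hκ : ∀ k, ‖c k‖ ^ 2 ≤ κ * (-(2 * (lam k).re))) (hκ0 : 0 ≤ κ)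
    (hg : Continuous g) {t : ℝ} (ht : 0 ≤ t) (k : ℤ) :
    ‖duhamel lam c g t k‖ ^ 2 ≤ κ * ∫ ξ in (0 : ℝ)..t, ‖g ξ k‖ ^ 2 := by
  have hgk := (SeqL2.continuous_apply k).comp hg
  simp only [Function.comp_def] at hgk
  have h1 : ‖duhamel lam c g t k‖ ≤
      ‖c k‖ * ∫ ξ in (0 : ℝ)..t, Real.exp ((lam k).re * (t - ξ)) * ‖g ξ k‖ := by
    rw [← intervalIntegral.integral_const_mul]
    refine (intervalIntegral.norm_integral_le_integral_norm ht).trans (le_of_eq ?_)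
    refine intervalIntegral.integral_congr fun ξ _ => ?_
    simp only [norm_mul, norm_exp_mul_real]
    ring
  have h2 := sq_integral_mul_le (f := fun ξ => Real.exp ((lam k).re * (t - ξ)))
    (g := fun ξ => ‖g ξ k‖) (by fun_prop) hgk.norm ht
  have h3 : ∀ ξ, Real.exp ((lam k).re * (t - ξ)) ^ 2 =
      Real.exp ((2 * (lam k).re) * (t - ξ)) := fun ξ => by
    rw [← Real.exp_nat_mul]
    congr 1
    push_cast
    ring
  simp_rw [h3] at h2
  have h4 := mul_integral_exp_le (2 * (lam k).re) t
  set E := ∫ ξ in (0 : ℝ)..t, Real.exp ((2 * (lam k).re) * (t - ξ)) with hE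
  set N := ∫ ξ in (0 : ℝ)..t, ‖g ξ k‖ ^ 2
  have hE0 : 0 ≤ E := intervalIntegral.integral_nonneg ht fun ξ _ => (Real.exp_pos _).le
  have hN0 : 0 ≤ N := intervalIntegral.integral_nonneg ht fun ξ _ => by positivity
  calc ‖duhamel lam c g t k‖ ^ 2
      ≤ (‖c k‖ * ∫ ξ in (0 : ℝ)..t, Real.exp ((lam k).re * (t - ξ)) * ‖g ξ k‖) ^ 2 :=
        pow_le_pow_left₀ (norm_nonneg _) h1 2
    _ ≤ ‖c k‖ ^ 2 * (E * N) := by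
        rw [mul_pow]
        exact mul_le_mul_of_nonneg_left h2 (by positivity)
    _ ≤ (κ * (-(2 * (lam k).re))) * (E * N) :=
        mul_le_mul_of_nonneg_right (hκ k) (mul_nonneg hE0 hN0)
    _ = κ * ((-(2 * (lam k).re)) * E) * N := by ring
    _ ≤ κ * 1 * N := by gcongr
    _ = κ * N := by ring

theorem summable_integral_sq (hg : Continuous g) {t : ℝ} (ht : 0 ≤ t) :
    Summable (fun k => ∫ ξ in (0 : ℝ)..t, ‖g ξ k‖ ^ 2) ∧
      ∑' k, ∫ ξ in (0 : ℝ)..t, ‖g ξ k‖ ^ 2 ≤ ∫ ξ in (0 : ℝ)..t, ‖g ξ‖ ^ 2 := by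
  have hgk : ∀ k, Continuous fun ξ => ‖g ξ k‖ ^ 2 := fun k =>
    (((SeqL2.continuous_apply k).comp hg).norm.pow 2)
  have h0 : ∀ k, 0 ≤ ∫ ξ in (0 : ℝ)..t, ‖g ξ k‖ ^ 2 := fun k =>
    intervalIntegral.integral_nonneg ht fun ξ _ => by positivity
  have h1 : ∀ F : Finset ℤ, ∑ k ∈ F, ∫ ξ in (0 : ℝ)..t, ‖g ξ k‖ ^ 2 ≤
      ∫ ξ in (0 : ℝ)..t, ‖g ξ‖ ^ 2 := fun F => by
    rw [← intervalIntegral.integral_finsetSum fun k _ => (hgk k).intervalIntegrable _ _]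
    refine intervalIntegral.integral_mono_on ht
      (Continuous.intervalIntegrable (by fun_prop) _ _)
      (Continuous.intervalIntegrable (by fun_prop) _ _) fun ξ _ => ?_
    have h2 := SeqL2.hasSum_sq (g ξ)
    rw [← h2.tsum_eq]
    exact h2.summable.sum_le_tsum F fun k _ => by positivity
  exact ⟨summable_of_sum_le h0 h1, Real.tsum_le_of_sum_le h0 h1⟩

theorem duhamel_summable (hκ : ∀ k, ‖c k‖ ^ 2 ≤ κ * (-(2 * (lam k).re))) (hκ0 : 0 ≤ κ)
    (hg : Continuous g) {t : ℝ} (ht : 0 ≤ t) :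
    Summable (fun k => ‖duhamel lam c g t k‖ ^ 2) ∧
      ∑' k, ‖duhamel lam c g t k‖ ^ 2 ≤ κ * ∫ ξ in (0 : ℝ)..t, ‖g ξ‖ ^ 2 := by
  obtain ⟨h1, h2⟩ := summable_integral_sq hg ht
  have h3 := norm_duhamel_sq_le hκ hκ0 hg ht
  have h4 := (h1.mul_left κ).of_nonneg_of_le (fun k => by positivity) h3
  refine ⟨h4, (h4.tsum_le_tsum h3 (h1.mul_left κ)).trans ?_⟩
  rw [tsum_mul_left]
  exact mul_le_mul_of_nonneg_left h2 hκ0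

theorem re_nonpos_of_le (hκ : ∀ k, ‖c k‖ ^ 2 ≤ κ * (-(2 * (lam k).re))) (hκ0 : 0 < κ) (k : ℤ) :
    (lam k).re ≤ 0 := by
  have := nonneg_of_mul_nonneg_right ((sq_nonneg _).trans (hκ k)) hκ0
  linarith

theorem norm_exp_mul_le_one {z : ℂ} (hz : z.re ≤ 0) {t : ℝ} (ht : 0 ≤ t) :
    ‖Complex.exp (z * t)‖ ≤ 1 := by
  rw [norm_exp_mul_real, Real.exp_le_one_iff]
  exact mul_nonpos_of_nonpos_of_nonneg hz ht

end

/-! ### Picard iteration for globally Lipschitz nonlinearities -/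

/-- The right-hand side of the integral equation in Fourier space. -/
def mild (lam c : ℤ → ℂ) (a₀ : SeqL2) (g : ℝ → SeqL2) (t : ℝ) (k : ℤ) : ℂ :=
  Complex.exp (lam k * t) * a₀ k + duhamel lam c g t k

section
variable {lam c : ℤ → ℂ} {κ : ℝ} {g : ℝ → SeqL2}

theorem norm_mild_sq_le (hκ : ∀ k, ‖c k‖ ^ 2 ≤ κ * (-(2 * (lam k).re))) (hκ0 : 0 < κ)
    (hg : Continuous g) (a₀ : SeqL2) {t T : ℝ} (ht : 0 ≤ t) (htT : t ≤ T) (k : ℤ) :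
    ‖mild lam c a₀ g t k‖ ^ 2 ≤ 2 * ‖a₀ k‖ ^ 2 + 2 * (κ * ∫ ξ in (0 : ℝ)..T, ‖g ξ k‖ ^ 2) := by
  have hgk : Continuous fun ξ => ‖g ξ k‖ ^ 2 :=
    (((SeqL2.continuous_apply k).comp hg).norm.pow 2)
  have h1 : ‖Complex.exp (lam k * t) * a₀ k‖ ≤ ‖a₀ k‖ := by
    rw [norm_mul]
    exact mul_le_of_le_one_left (norm_nonneg _)
      (norm_exp_mul_le_one (re_nonpos_of_le hκ hκ0 k) ht)
  have h2 := norm_duhamel_sq_le hκ hκ0.le hg ht k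
  have h3 : ∫ ξ in (0 : ℝ)..t, ‖g ξ k‖ ^ 2 ≤ ∫ ξ in (0 : ℝ)..T, ‖g ξ k‖ ^ 2 :=
    intervalIntegral.integral_mono_interval le_rfl ht htT
      (Eventually.of_forall fun ξ => by positivity) (hgk.intervalIntegrable _ _)
  have h4 := mul_le_mul_of_nonneg_left h3 hκ0.le
  have h5 : ‖mild lam c a₀ g t k‖ ≤ ‖a₀ k‖ + ‖duhamel lam c g t k‖ :=
    (norm_add_le _ _).trans (add_le_add_left h1 _)
  have h6 := pow_le_pow_left₀ (norm_nonneg _) h5 2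
  nlinarith [sq_nonneg (‖a₀ k‖ - ‖duhamel lam c g t k‖)]

theorem summable_mild_bound (hg : Continuous g) (a₀ : SeqL2) {T : ℝ} (hT : 0 ≤ T) :
    Summable fun k => 2 * ‖a₀ k‖ ^ 2 + 2 * (κ * ∫ ξ in (0 : ℝ)..T, ‖g ξ k‖ ^ 2) :=
  ((SeqL2.hasSum_sq a₀).summable.mul_left 2).add
    (((summable_integral_sq hg hT).1.mul_left κ).mul_left 2)

theorem memℓp_mild (hκ : ∀ k, ‖c k‖ ^ 2 ≤ κ * (-(2 * (lam k).re))) (hκ0 : 0 < κ)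
    (hg : Continuous g) (a₀ : SeqL2) {t : ℝ} (ht : 0 ≤ t) : Memℓp (mild lam c a₀ g t) 2 :=
  memℓp_two_iff.mpr <| (summable_mild_bound hg a₀ ht).of_nonneg_of_le (fun k => by positivity)
    (norm_mild_sq_le hκ hκ0 hg a₀ ht le_rfl)

/-- The map whose fixed points are the mild solutions. -/
def mildMap (hκ : ∀ k, ‖c k‖ ^ 2 ≤ κ * (-(2 * (lam k).re))) (hκ0 : 0 < κ) {T : ℝ} (hT : 0 ≤ T)
    (G : C(SeqL2, SeqL2)) (a₀ : SeqL2) (a : C(Icc 0 T, SeqL2)) : C(Icc 0 T, SeqL2) where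
  toFun t := ⟨mild lam c a₀ (fun ξ => G (IccExtend hT a ξ)) t,
    memℓp_mild hκ hκ0 (G.continuous.comp a.continuous.Icc_extend') a₀ t.2.1⟩
  continuous_toFun := by
    have hg := G.continuous.comp (a.continuous.Icc_extend' (h := hT))
    refine continuous_iff_continuousAt.mpr fun t => ?_
    refine SeqL2.tendsto_of_dominated (summable_mild_bound hg a₀ hT) (fun k => ?_)
      (Eventually.of_forall fun x => norm_mild_sq_le hκ hκ0 hg a₀ x.2.1 x.2.2)
      (norm_mild_sq_le hκ hκ0 hg a₀ t.2.1 t.2.2)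
    have h1 := (continuous_duhamel (lam := lam) (c := c) hg k).comp continuous_subtype_val
      (X := Icc (0 : ℝ) T)
    have h2 : Continuous fun x : Icc (0 : ℝ) T => Complex.exp (lam k * (x : ℝ)) * a₀ k := by
      fun_prop
    exact (h2.add h1).continuousAt

theorem mildMap_sub_sq_le (hκ : ∀ k, ‖c k‖ ^ 2 ≤ κ * (-(2 * (lam k).re))) (hκ0 : 0 < κ) {T : ℝ}
    (hT : 0 ≤ T) {G : C(SeqL2, SeqL2)} {K : ℝ} (hG : ∀ x y, ‖G x - G y‖ ≤ K * ‖x - y‖)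
    (a₀ : SeqL2) (a b : C(Icc 0 T, SeqL2)) (t : Icc 0 T) :
    ‖mildMap hκ hκ0 hT G a₀ a t - mildMap hκ hκ0 hT G a₀ b t‖ ^ 2 ≤
      κ * K ^ 2 * ∫ ξ in (0 : ℝ)..t, ‖IccExtend hT a ξ - IccExtend hT b ξ‖ ^ 2 := by
  have ha := a.continuous.Icc_extend' (h := hT)
  have hb := b.continuous.Icc_extend' (h := hT)
  have hga : Continuous fun ξ => G (IccExtend hT a ξ) := G.continuous.comp ha
  have hgb : Continuous fun ξ => G (IccExtend hT b ξ) := G.continuous.comp hb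
  have h1 := duhamel_summable hκ hκ0.le (hga.sub hgb) t.2.1
  have e : ∀ k, (mildMap hκ hκ0 hT G a₀ a t - mildMap hκ hκ0 hT G a₀ b t) k =
      duhamel lam c (fun ξ => G (IccExtend hT a ξ) - G (IccExtend hT b ξ)) t k := fun k => by
    rw [duhamel_sub hga hgb]
    exact add_sub_add_left_eq_sub _ _ _
  rw [← (SeqL2.hasSum_sq _).tsum_eq]
  simp_rw [e]
  refine h1.2.trans ?_
  rw [mul_assoc]
  refine mul_le_mul_of_nonneg_left ?_ hκ0.le
  rw [← intervalIntegral.integral_const_mul]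
  refine intervalIntegral.integral_mono_on t.2.1
    (((hga.sub hgb).norm.pow 2).intervalIntegrable _ _)
    ((((ha.sub hb).norm.pow 2).const_mul _).intervalIntegrable _ _) fun ξ _ => ?_
  rw [← mul_pow]
  exact pow_le_pow_left₀ (norm_nonneg _) (hG _ _) 2

/-- Each further iteration integrates the previous power of time once more, which produces the
factorial. -/
theorem mildMap_iterate_sub_sq_le (hκ : ∀ k, ‖c k‖ ^ 2 ≤ κ * (-(2 * (lam k).re))) (hκ0 : 0 < κ)
    {T : ℝ} (hT : 0 ≤ T) {G : C(SeqL2, SeqL2)} {K : ℝ} (hG : ∀ x y, ‖G x - G y‖ ≤ K * ‖x - y‖)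
    (a₀ : SeqL2) (a b : C(Icc 0 T, SeqL2)) (n : ℕ) (t : Icc 0 T) :
    ‖(mildMap hκ hκ0 hT G a₀)^[n] a t - (mildMap hκ hκ0 hT G a₀)^[n] b t‖ ^ 2 ≤
      (κ * K ^ 2 * t) ^ n / n.factorial * dist a b ^ 2 := by
  induction n generalizing t with
  | zero =>
    simp only [Function.iterate_zero, id, pow_zero, Nat.factorial_zero, Nat.cast_one, div_one,
      one_mul]
    rw [← dist_eq_norm]
    exact pow_le_pow_left₀ dist_nonneg (ContinuousMap.dist_apply_le_dist t) 2
  | succ n ih =>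
    rw [Function.iterate_succ_apply', Function.iterate_succ_apply']
    refine (mildMap_sub_sq_le hκ hκ0 hT hG a₀ _ _ t).trans ?_
    set a' := (mildMap hκ hκ0 hT G a₀)^[n] a
    set b' := (mildMap hκ hκ0 hT G a₀)^[n] b
    have ha := a'.continuous.Icc_extend' (h := hT)
    have hb := b'.continuous.Icc_extend' (h := hT)
    have h1 : ∫ ξ in (0 : ℝ)..t, ‖IccExtend hT a' ξ - IccExtend hT b' ξ‖ ^ 2 ≤
        ∫ ξ in (0 : ℝ)..t, ((κ * K ^ 2) ^ n / n.factorial * dist a b ^ 2) * ξ ^ n := by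
      refine intervalIntegral.integral_mono_on t.2.1
        (((ha.sub hb).norm.pow 2).intervalIntegrable _ _)
        (Continuous.intervalIntegrable (by fun_prop) _ _) fun ξ hξ => ?_
      have hξ' : ξ ∈ Icc 0 T := ⟨hξ.1, hξ.2.trans t.2.2⟩
      rw [IccExtend_of_mem hT _ hξ', IccExtend_of_mem hT _ hξ']
      refine (ih ⟨ξ, hξ'⟩).trans (le_of_eq ?_)
      simp only [mul_pow]
      ring
    refine (mul_le_mul_of_nonneg_left h1 (by positivity)).trans (le_of_eq ?_)
    rw [intervalIntegral.integral_const_mul, integral_pow, Nat.factorial_succ]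
    have : (n.factorial : ℝ) ≠ 0 := by positivity
    push_cast
    field_simp
    ring

theorem existsUnique_mild (hκ : ∀ k, ‖c k‖ ^ 2 ≤ κ * (-(2 * (lam k).re))) (hκ0 : 0 < κ) {T : ℝ}
    (hT : 0 ≤ T) {G : C(SeqL2, SeqL2)} {K : ℝ} (hG : ∀ x y, ‖G x - G y‖ ≤ K * ‖x - y‖)
    (a₀ : SeqL2) : ∃ a : C(Icc 0 T, SeqL2),
      (∀ t k, a t k = mild lam c a₀ (fun ξ => G (IccExtend hT a ξ)) t k) ∧
      ∀ b : C(Icc 0 T, SeqL2),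
        (∀ t k, b t k = mild lam c a₀ (fun ξ => G (IccExtend hT b ξ)) t k) → b = a := by
  have hlim := FloorSemiring.tendsto_pow_div_factorial_atTop (κ * K ^ 2 * T)
  -- The iterates are controlled in squared norm, so `1 / 4` gives the contraction factor `1 / 2`.
  obtain ⟨n, hn⟩ := (hlim.eventually_lt_const (by norm_num : (0 : ℝ) < 1 / 4)).exists
  have hcontr : ContractingWith (1 / 2) (mildMap hκ hκ0 hT G a₀)^[n] := by
    refine ⟨by norm_num [← NNReal.coe_lt_coe], LipschitzWith.of_dist_le_mul fun a b => ?_⟩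
    rw [ContinuousMap.dist_le (by positivity)]
    intro t
    rw [dist_eq_norm]
    refine abs_le_of_sq_le_sq' ?_ (by positivity) |>.2
    refine (mildMap_iterate_sub_sq_le hκ hκ0 hT hG a₀ a b n t).trans ?_
    have h1 : (κ * K ^ 2 * t) ^ n / n.factorial ≤ 1 / 4 := by
      refine le_trans ?_ hn.le
      have := t.2.1
      have := t.2.2
      gcongr
    rw [mul_pow _ (dist a b)]
    refine mul_le_mul_of_nonneg_right (h1.trans (le_of_eq ?_)) (by positivity)
    norm_num
  have hfix : ∀ b : C(Icc 0 T, SeqL2), Function.IsFixedPt (mildMap hκ hκ0 hT G a₀) b ↔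
      ∀ t k, b t k = mild lam c a₀ (fun ξ => G (IccExtend hT b ξ)) t k := fun b => by
    constructor
    · intro h t k
      conv_lhs => rw [← h.eq]
      rfl
    · intro h
      ext t k
      exact (h t k).symm
  refine ⟨ContractingWith.fixedPoint _ hcontr, (hfix _).mp hcontr.isFixedPt_fixedPoint_iterate,
    fun b hb => ?_⟩
  exact hcontr.fixedPoint_unique (((hfix b).mpr hb).iterate n)

end

/-! ### The cubic nonlinearity on weighted coefficients -/

/-- The Fourier coefficients of the element of `H^s` with weighted coefficients `a`. -/
def unwt (s : ℝ) (a : ℤ → ℂ) (k : ℤ) : ℂ := wt (-s) k * a k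

theorem norm_unwt (s : ℝ) (a : ℤ → ℂ) (k : ℤ) : ‖unwt s a k‖ = wt (-s) k * ‖a k‖ := by
  rw [unwt, norm_mul, Complex.norm_real, Real.norm_of_nonneg (wt_pos _ _).le]

theorem wt_mul_unwt (s : ℝ) (a : ℤ → ℂ) (k : ℤ) : (wt s k : ℂ) * unwt s a k = a k := by
  rw [unwt, ← mul_assoc, ← Complex.ofReal_mul, wt_mul_neg, Complex.ofReal_one, one_mul]

theorem unwt_wt_mul (s : ℝ) (a : ℤ → ℂ) (k : ℤ) : unwt s (fun k => wt s k * a k) k = a k := by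
  rw [unwt, ← mul_assoc, ← Complex.ofReal_mul, wt_neg_mul, Complex.ofReal_one, one_mul]

theorem wt_mul_norm_unwt_sq (s : ℝ) (a : ℤ → ℂ) (k : ℤ) :
    wt (2 * s) k * ‖unwt s a k‖ ^ 2 = ‖a k‖ ^ 2 := by
  conv_rhs => rw [← wt_mul_unwt s a k]
  rw [norm_mul, Complex.norm_real, Real.norm_of_nonneg (wt_pos _ _).le, mul_pow, wt_sq]

theorem hasSum_unwt (s : ℝ) (a : SeqL2) :
    HasSum (fun k => wt (2 * s) k * ‖unwt s a k‖ ^ 2) (‖a‖ ^ 2) := by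
  simp_rw [wt_mul_norm_unwt_sq]
  exact SeqL2.hasSum_sq a

theorem norm_wt_mul_sq (s : ℝ) (z : ℂ) (k : ℤ) :
    ‖(wt s k : ℂ) * z‖ ^ 2 = wt (2 * s) k * ‖z‖ ^ 2 := by
  rw [norm_mul, Complex.norm_real, Real.norm_of_nonneg (wt_pos _ _).le, mul_pow, wt_sq]

section
variable {s : ℝ} (hs : 1 / 2 < s)

/-- The product of two functions in `H^s`, in terms of weighted Fourier coefficients. -/
def hmul (a b : SeqL2) : SeqL2 :=
  ⟨fun k => wt s k * conv (unwt s a) (unwt s b) k, memℓp_two_iff.mpr <| by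
    simp_rw [norm_wt_mul_sq]
    exact (summable_wt_conv hs (hasSum_unwt s a).summable (hasSum_unwt s b).summable).1⟩

theorem hmul_apply (a b : SeqL2) (k : ℤ) :
    hmul hs a b k = wt s k * conv (unwt s a) (unwt s b) k := rfl

theorem norm_hmul_le (a b : SeqL2) : ‖hmul hs a b‖ ≤ √(algConst s) * (‖a‖ * ‖b‖) := by
  refine abs_le_of_sq_le_sq' ?_ (by positivity) |>.2
  rw [mul_pow, Real.sq_sqrt (algConst_nonneg s), mul_pow, ← (SeqL2.hasSum_sq _).tsum_eq]
  simp_rw [hmul_apply, norm_wt_mul_sq]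
  have h := (summable_wt_conv hs (hasSum_unwt s a).summable (hasSum_unwt s b).summable).2
  rwa [(hasSum_unwt s a).tsum_eq, (hasSum_unwt s b).tsum_eq] at h

theorem summable_conv_unwt {s : ℝ} (hs : 1 / 2 < s) (a b : SeqL2) (k : ℤ) :
    Summable fun p => unwt s a p * unwt s b (k - p) :=
  summable_conv_of_sq (summable_sq_of_wt (by linarith) (hasSum_unwt s a).summable)
    (summable_sq_of_wt (by linarith) (hasSum_unwt s b).summable) k

theorem unwt_sub (a b : SeqL2) (k : ℤ) : unwt s (a - b : SeqL2) k = unwt s a k - unwt s b k := by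
  simp only [unwt, lp.coeFn_sub, Pi.sub_apply, mul_sub]

theorem conv_unwt_sub_left {s : ℝ} (hs : 1 / 2 < s) (a a' b : SeqL2) (k : ℤ) :
    conv (unwt s (a - a' : SeqL2)) (unwt s b) k =
      conv (unwt s a) (unwt s b) k - conv (unwt s a') (unwt s b) k := by
  unfold conv
  rw [← (summable_conv_unwt hs a b k).tsum_sub (summable_conv_unwt hs a' b k)]
  simp_rw [unwt_sub, sub_mul]

theorem conv_unwt_sub_right {s : ℝ} (hs : 1 / 2 < s) (a b b' : SeqL2) (k : ℤ) :
    conv (unwt s a) (unwt s (b - b' : SeqL2)) k =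
      conv (unwt s a) (unwt s b) k - conv (unwt s a) (unwt s b') k := by
  unfold conv
  rw [← (summable_conv_unwt hs a b k).tsum_sub (summable_conv_unwt hs a b' k)]
  simp_rw [unwt_sub, mul_sub]

theorem hmul_sub_left (a a' b : SeqL2) : hmul hs (a - a') b = hmul hs a b - hmul hs a' b := by
  ext k
  rw [lp.coeFn_sub, Pi.sub_apply, hmul_apply, hmul_apply, hmul_apply,
    conv_unwt_sub_left hs, mul_sub]

theorem hmul_sub_right (a b b' : SeqL2) : hmul hs a (b - b') = hmul hs a b - hmul hs a b' := by
  ext k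
  rw [lp.coeFn_sub, Pi.sub_apply, hmul_apply, hmul_apply, hmul_apply,
    conv_unwt_sub_right hs, mul_sub]

/-- Complex conjugation of functions, in terms of Fourier coefficients. -/
def hrefl (a : SeqL2) : SeqL2 :=
  ⟨refl a, memℓp_two_iff.mpr <| by
    simp_rw [norm_refl]
    exact (Equiv.neg ℤ).summable_iff.mpr (SeqL2.hasSum_sq a).summable⟩

theorem hrefl_apply (a : SeqL2) (k : ℤ) : hrefl a k = refl a k := rfl

theorem norm_hrefl (a : SeqL2) : ‖hrefl a‖ = ‖a‖ := by
  refine (sq_eq_sq₀ (norm_nonneg _) (norm_nonneg _)).mp ?_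
  rw [← (SeqL2.hasSum_sq _).tsum_eq, ← (SeqL2.hasSum_sq a).tsum_eq]
  simp_rw [hrefl_apply, norm_refl]
  exact (Equiv.neg ℤ).tsum_eq fun k => ‖a k‖ ^ 2

theorem hrefl_sub (a b : SeqL2) : hrefl (a - b) = hrefl a - hrefl b := by
  ext k
  simp only [lp.coeFn_sub, Pi.sub_apply, hrefl_apply, refl, map_sub]

theorem unwt_hrefl (a : SeqL2) : unwt s (hrefl a) = refl (unwt s a) := by
  funext k
  simp [unwt, hrefl_apply, refl, wt_neg_arg]

/-- The cubic nonlinearity in terms of weighted Fourier coefficients. -/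
def hcub (a : SeqL2) : SeqL2 := hmul hs (hmul hs a (hrefl a)) a

theorem hcub_apply (a : SeqL2) (k : ℤ) : hcub hs a k = wt s k * cub (unwt s a) k := by
  have h : unwt s (hmul hs a (hrefl a)) = conv (unwt s a) (refl (unwt s a)) := by
    funext k
    rw [← unwt_hrefl]
    exact unwt_wt_mul s _ k
  rw [hcub, hmul_apply, h, cub]

/-- The difference telescopes into three trilinear terms with one factor `a - b` (or its reflection,
of equal norm); the algebra property is applied twice in each. -/
theorem norm_hcub_sub_le {R : ℝ} {a b : SeqL2} (ha : ‖a‖ ≤ R) (hb : ‖b‖ ≤ R) :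
    ‖hcub hs a - hcub hs b‖ ≤ 3 * algConst s * R ^ 2 * ‖a - b‖ := by
  have e : hcub hs a - hcub hs b = hmul hs (hmul hs (a - b) (hrefl a)) a
      + hmul hs (hmul hs b (hrefl (a - b))) a + hmul hs (hmul hs b (hrefl b)) (a - b) := by
    simp only [hcub, hrefl_sub, hmul_sub_left, hmul_sub_right]
    abel
  have hR : 0 ≤ R := (norm_nonneg _).trans ha
  set K := √(algConst s) with hK
  have hK0 : 0 ≤ K := Real.sqrt_nonneg _
  have hKK : algConst s = K * K := (Real.mul_self_sqrt (algConst_nonneg s)).symm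
  have tri : ∀ x y z : SeqL2, ‖hmul hs (hmul hs x y) z‖ ≤ K * K * (‖x‖ * ‖y‖ * ‖z‖) := by
    intro x y z
    have h1 := norm_hmul_le hs (hmul hs x y) z
    have h2 := norm_hmul_le hs x y
    have h3 := mul_le_mul_of_nonneg_left (mul_le_mul_of_nonneg_right h2 (norm_nonneg z)) hK0
    linarith
  have h1 := tri (a - b) (hrefl a) a
  have h2 := tri b (hrefl (a - b)) a
  have h3 := tri b (hrefl b) (a - b)
  rw [norm_hrefl] at h1 h2 h3
  have b1 : ‖a - b‖ * ‖a‖ * ‖a‖ ≤ ‖a - b‖ * R * R := by gcongr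
  have b2 : ‖b‖ * ‖a - b‖ * ‖a‖ ≤ R * ‖a - b‖ * R := by gcongr
  have b3 : ‖b‖ * ‖b‖ * ‖a - b‖ ≤ R * R * ‖a - b‖ := by gcongr
  have hKK0 := mul_nonneg hK0 hK0
  have c1 := mul_le_mul_of_nonneg_left b1 hKK0
  have c2 := mul_le_mul_of_nonneg_left b2 hKK0
  have c3 := mul_le_mul_of_nonneg_left b3 hKK0
  rw [e, hKK]
  refine (norm_add₃_le).trans ?_
  linarith

theorem conv_smul_left (r : ℂ) (a b : ℤ → ℂ) (k : ℤ) :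
    conv (fun k => r * a k) b k = r * conv a b k := by
  simp only [conv, mul_assoc, tsum_mul_left]

theorem conv_smul_right (r : ℂ) (a b : ℤ → ℂ) (k : ℤ) :
    conv a (fun k => r * b k) k = r * conv a b k := by
  simp only [conv, mul_left_comm _ r, tsum_mul_left]

theorem cub_real_mul (r : ℝ) (v : ℤ → ℂ) (k : ℤ) :
    cub (fun k => r * v k) k = (r : ℂ) ^ 3 * cub v k := by
  have h1 : refl (fun k => (r : ℂ) * v k) = fun k => r * refl v k := by
    funext k
    simp [refl]
  have h2 : conv (fun k => (r : ℂ) * v k) (refl fun k => (r : ℂ) * v k) =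
      fun k => (r : ℂ) * (r * conv v (refl v) k) := by
    funext k
    rw [h1, conv_smul_left, conv_smul_right]
  rw [cub, h2, conv_smul_right, conv_smul_left, conv_smul_left, cub]
  ring

end

/-! ### Truncation by radial retraction -/

/-- The scaling factor of the radial retraction onto the ball of radius `R`. -/
def retrFactor (R : ℝ) (a : SeqL2) : ℝ := R / max R ‖a‖

/-- The radial retraction onto the ball of radius `R`. -/
def retr (R : ℝ) (a : SeqL2) : SeqL2 := (retrFactor R a : ℂ) • a

section
variable {R : ℝ}

theorem retrFactor_nonneg (hR : 0 < R) (a : SeqL2) : 0 ≤ retrFactor R a := by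
  unfold retrFactor
  have : 0 < max R ‖a‖ := lt_max_of_lt_left hR
  positivity

theorem retrFactor_le_one (hR : 0 < R) (a : SeqL2) : retrFactor R a ≤ 1 :=
  div_le_one_of_le₀ (le_max_left _ _) (hR.le.trans (le_max_left _ _))

theorem retrFactor_of_le (hR : 0 < R) {a : SeqL2} (ha : ‖a‖ ≤ R) : retrFactor R a = 1 := by
  rw [retrFactor, max_eq_left ha, div_self hR.ne']

theorem retr_of_le (hR : 0 < R) {a : SeqL2} (ha : ‖a‖ ≤ R) : retr R a = a := by
  rw [retr, retrFactor_of_le hR ha, Complex.ofReal_one, one_smul]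

theorem norm_retr_le (hR : 0 < R) (a : SeqL2) : ‖retr R a‖ ≤ R := by
  rw [retr, norm_smul, Complex.norm_real, Real.norm_of_nonneg (retrFactor_nonneg hR a), retrFactor]
  have h : 0 < max R ‖a‖ := lt_max_of_lt_left hR
  rw [div_mul_eq_mul_div, div_le_iff₀ h]
  exact mul_le_mul_of_nonneg_left (le_max_right _ _) hR.le

theorem norm_retr_sub_le (hR : 0 < R) (a b : SeqL2) : ‖retr R a - retr R b‖ ≤ 2 * ‖a - b‖ := by
  have e : retr R a - retr R b = (retrFactor R a : ℂ) • (a - b)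
      + ((retrFactor R a - retrFactor R b : ℝ) : ℂ) • b := by
    simp only [retr, smul_sub, Complex.ofReal_sub, sub_smul]
    abel
  have h1 : ‖(retrFactor R a : ℂ) • (a - b)‖ ≤ ‖a - b‖ := by
    rw [norm_smul, Complex.norm_real, Real.norm_of_nonneg (retrFactor_nonneg hR a)]
    exact mul_le_of_le_one_left (norm_nonneg _) (retrFactor_le_one hR a)
  have h2 : ‖((retrFactor R a - retrFactor R b : ℝ) : ℂ) • b‖ ≤ ‖a - b‖ := by
    rw [norm_smul, Complex.norm_real, Real.norm_eq_abs]
    have ha : 0 < max R ‖a‖ := lt_max_of_lt_left hR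
    have hb : 0 < max R ‖b‖ := lt_max_of_lt_left hR
    have h3 : retrFactor R a - retrFactor R b =
        R * (max R ‖b‖ - max R ‖a‖) / (max R ‖a‖ * max R ‖b‖) := by
      unfold retrFactor
      field_simp
    have h4 : |max R ‖b‖ - max R ‖a‖| ≤ ‖a - b‖ := by
      rw [max_comm R, max_comm R, norm_sub_rev]
      exact (abs_max_sub_max_le_abs _ _ _).trans (abs_norm_sub_norm_le b a)
    rw [h3, abs_div, abs_mul, abs_of_pos hR, abs_of_pos (mul_pos ha hb), div_mul_eq_mul_div,
      div_le_iff₀ (mul_pos ha hb)]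
    have h5 : R * ‖b‖ ≤ max R ‖a‖ * max R ‖b‖ :=
      mul_le_mul (le_max_left _ _) (le_max_right _ _) (norm_nonneg _) ha.le
    calc R * |max R ‖b‖ - max R ‖a‖| * ‖b‖ = |max R ‖b‖ - max R ‖a‖| * (R * ‖b‖) := by ring
      _ ≤ ‖a - b‖ * (max R ‖a‖ * max R ‖b‖) :=
        mul_le_mul h4 h5 (by positivity) (norm_nonneg _)
  rw [e]
  refine (norm_add_le _ _).trans ?_
  linarith

end

section
variable {s R : ℝ} (hs : 1 / 2 < s)

theorem norm_hcub_retr_sub_le (hR : 0 < R) (a b : SeqL2) :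
    ‖hcub hs (retr R a) - hcub hs (retr R b)‖ ≤
    3 * algConst s * R ^ 2 * 2 * ‖a - b‖ := by
  have h1 := norm_hcub_sub_le hs (norm_retr_le hR a) (norm_retr_le hR b)
  have h2 := mul_le_mul_of_nonneg_left (norm_retr_sub_le hR a b)
    (by have := algConst_nonneg s; positivity : 0 ≤ 3 * algConst s * R ^ 2)
  linarith

/-- The truncated cubic nonlinearity, which is globally Lipschitz continuous. -/
def truncCub (hR : 0 < R) : C(SeqL2, SeqL2) where
  toFun a := hcub hs (retr R a)
  continuous_toFun := LipschitzWith.continuous (K := (3 * algConst s * R ^ 2 * 2).toNNReal) <|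
    LipschitzWith.of_dist_le' fun a b => by
      rw [dist_eq_norm, dist_eq_norm]
      exact norm_hcub_retr_sub_le hs hR a b

theorem truncCub_sub_le (hR : 0 < R) (a b : SeqL2) : ‖truncCub hs hR a - truncCub hs hR b‖ ≤
    3 * algConst s * R ^ 2 * 2 * ‖a - b‖ :=
  norm_hcub_retr_sub_le hs hR a b

theorem truncCub_of_le (hR : 0 < R) {a : SeqL2} (ha : ‖a‖ ≤ R) : truncCub hs hR a = hcub hs a :=
  congrArg (hcub hs) (retr_of_le hR ha)

/-- The retraction is multiplication by a real scalar and the nonlinearity is homogeneous of degree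
3 under real scalars. The truncated term is therefore a multiple of the true one, which keeps the
energy cancellation intact. -/
theorem truncCub_apply (hR : 0 < R) (a : SeqL2) (k : ℤ) : truncCub hs hR a k =
    (retrFactor R a : ℂ) ^ 3 * (wt s k * cub (unwt s a) k) := by
  have h : unwt s (retr R a) = fun k => (retrFactor R a : ℂ) * unwt s a k := by
    funext k
    simp only [unwt, retr, lp.coeFn_smul, Pi.smul_apply, smul_eq_mul]
    ring
  change hcub hs (retr R a) k = _
  rw [hcub_apply, h, cub_real_mul]
  ring

end

/-! ### Smoothing for positive times -/

theorem exists_exp_le_wt {ε : ℝ} (hε : 0 < ε) (r : ℝ) :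
    ∃ E : ℝ, 0 ≤ E ∧ ∀ k : ℤ, Real.exp (-(ε * (k : ℝ) ^ 2)) ≤ E * wt (-r) k := by
  obtain ⟨n, hn⟩ := exists_nat_ge (r / 2)
  -- From `y ^ n / n! ≤ exp y` at `y = ε (1 + k²)`; the factor `exp ε` compensates for the added 1.
  refine ⟨Real.exp ε * (n.factorial / ε ^ n), by positivity, fun k => ?_⟩
  set x : ℝ := 1 + (k : ℝ) ^ 2 with hx
  have hx1 : 1 ≤ x := by nlinarith [sq_nonneg (k : ℝ)]
  have h1 : wt r k ≤ x ^ n := by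
    rw [wt, ← Real.rpow_natCast x n]
    exact Real.rpow_le_rpow_of_exponent_le hx1 hn
  have h2 := Real.pow_div_factorial_le_exp (ε * x) (by positivity) n
  have h3 : x ^ n ≤ n.factorial / ε ^ n * Real.exp (ε * x) := by
    rw [div_le_iff₀ (by positivity), mul_pow] at h2
    rw [div_mul_eq_mul_div, le_div_iff₀ (by positivity)]
    linarith
  have h4 : Real.exp (-(ε * (k : ℝ) ^ 2)) * Real.exp (ε * x) = Real.exp ε := by
    rw [← Real.exp_add]
    congr 1
    rw [hx]
    ring
  have h5 := wt_mul_neg r k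
  have h6 := wt_pos (-r) k
  have h7 : Real.exp (-(ε * (k : ℝ) ^ 2)) * wt r k ≤
      Real.exp ε * (n.factorial / ε ^ n) := by
    refine (mul_le_mul_of_nonneg_left (h1.trans h3) (Real.exp_pos _).le).trans (le_of_eq ?_)
    rw [← h4]
    ring
  calc Real.exp (-(ε * (k : ℝ) ^ 2)) = Real.exp (-(ε * (k : ℝ) ^ 2)) * wt r k * wt (-r) k := by
        rw [mul_assoc, h5, mul_one]
    _ ≤ _ := mul_le_mul_of_nonneg_right h7 h6.le

theorem wt_one_le_two_mul_abs {k : ℤ} (hk : k ≠ 0) : wt 1 k ≤ 2 * |(k : ℝ)| := by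
  have h1 : (1 : ℝ) ≤ |(k : ℝ)| := by
    exact_mod_cast Int.one_le_abs hk
  refine abs_le_of_sq_le_sq' ?_ (by positivity) |>.2
  rw [wt_sq, mul_one, wt_two, mul_pow, sq_abs]
  have := sq_abs (k : ℝ)
  nlinarith

/-- The Duhamel integral splits into a rapidly decaying part and a part which gains one
derivative. -/
theorem norm_duhamel_le {lam c : ℤ → ℂ} {g : ℝ → SeqL2} (hg : Continuous g) {k : ℤ}
    (hre : (lam k).re ≤ 0) {τ t M N : ℝ} (hτ : 0 ≤ τ) (hτt : 2 * τ ≤ t)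
    (hM : ∀ ξ ∈ Icc 0 τ, ‖g ξ k‖ ≤ M) (hN : ∀ ξ ∈ Icc τ t, ‖g ξ k‖ ≤ N) :
    ‖duhamel lam c g t k‖ ≤ Real.exp ((lam k).re * τ) * (‖c k‖ * M) * τ
      + ‖c k‖ * N * ∫ ξ in (0 : ℝ)..t, Real.exp ((lam k).re * (t - ξ)) := by
  have hc := continuous_duhamel_integrand (lam := lam) (c := c) hg t k
  have hN0 : 0 ≤ N := (norm_nonneg _).trans (hN τ ⟨le_rfl, by linarith⟩)
  have hI : ∀ ξ, ‖Complex.exp (lam k * (t - ξ : ℝ)) * (c k * g ξ k)‖ =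
      Real.exp ((lam k).re * (t - ξ)) * (‖c k‖ * ‖g ξ k‖) := fun ξ => by
    rw [norm_mul, norm_mul, norm_exp_mul_real]
  rw [duhamel, ← intervalIntegral.integral_add_adjacent_intervals (b := τ)
    (hc.intervalIntegrable _ _) (hc.intervalIntegrable _ _)]
  refine (norm_add_le _ _).trans (add_le_add ?_ ?_)
  · refine (intervalIntegral.norm_integral_le_of_norm_le_const (C :=
      Real.exp ((lam k).re * τ) * (‖c k‖ * M)) fun ξ hξ => ?_).trans (le_of_eq ?_)
    · rw [uIoc_of_le hτ] at hξ
      rw [hI]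
      have h1 : (lam k).re * (t - ξ) ≤ (lam k).re * τ :=
        mul_le_mul_of_nonpos_left (by linarith [hξ.2]) hre
      have := hM ξ ⟨hξ.1.le, hξ.2⟩
      gcongr
    · rw [sub_zero, abs_of_nonneg hτ]
  · have hτt' : τ ≤ t := by linarith
    have hexp : Continuous fun ξ => Real.exp ((lam k).re * (t - ξ)) := by fun_prop
    have h1 : ∫ ξ in τ..t, ‖Complex.exp (lam k * (t - ξ : ℝ)) * (c k * g ξ k)‖ ≤
        ∫ ξ in τ..t, ‖c k‖ * N * Real.exp ((lam k).re * (t - ξ)) := by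
      refine intervalIntegral.integral_mono_on hτt' (hc.norm.intervalIntegrable _ _)
        ((hexp.const_mul _).intervalIntegrable _ _) fun ξ hξ => ?_
      rw [hI, mul_comm]
      have := hN ξ hξ
      gcongr
    refine (intervalIntegral.norm_integral_le_integral_norm hτt').trans (h1.trans ?_)
    rw [intervalIntegral.integral_const_mul]
    refine mul_le_mul_of_nonneg_left ?_ (by positivity)
    exact intervalIntegral.integral_mono_interval hτ hτt' le_rfl
      (Eventually.of_forall fun ξ => (Real.exp_pos _).le) (hexp.intervalIntegrable _ _)

section
variable {lam c : ℤ → ℂ} {ω η α Λ s R T : ℝ} {a : ℝ → SeqL2} {a₀ : SeqL2}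

theorem norm_symbol_eq (hω : 0 < ω) (hc : ∀ k, c k = -(α : ℂ) * Complex.I * (ω * k : ℝ)) (k : ℤ) :
    ‖c k‖ = |α| * (ω * |(k : ℝ)|) := by
  rw [hc, norm_mul, norm_mul, norm_neg, Complex.norm_I, Complex.norm_real, Complex.norm_real,
    Real.norm_eq_abs, Real.norm_eq_abs, abs_mul, abs_of_pos hω]
  ring

/-- The symbol grows like `|k|` while the time integral of the heat factor is `O(1 / k²)`, a net
gain of one derivative. At `k = 0` the symbol vanishes. -/
theorem norm_symbol_mul_integral_le (hω : 0 < ω) (hη : 0 < η)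
    (hlam : ∀ k, (lam k).re = -(η * (ω * k) ^ 2))
    (hc : ∀ k, c k = -(α : ℂ) * Complex.I * (ω * k : ℝ)) (k : ℤ) (t : ℝ) :
    ‖c k‖ * ∫ ξ in (0 : ℝ)..t, Real.exp ((lam k).re * (t - ξ)) ≤
      |α| * 2 / (η * ω) * wt (-1) k := by
  have hw := wt_pos (-1) k
  rw [norm_symbol_eq hω hc]
  rcases eq_or_ne k 0 with rfl | hk
  · simp
    positivity
  have h1 := mul_integral_exp_le (lam k).re t
  set E := ∫ ξ in (0 : ℝ)..t, Real.exp ((lam k).re * (t - ξ))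
  rw [hlam, neg_neg] at h1
  have h2 := wt_one_le_two_mul_abs hk
  have h3 : 1 ≤ 2 * |(k : ℝ)| * wt (-1) k := by
    exact (wt_mul_neg 1 k).ge.trans (mul_le_mul_of_nonneg_right h2 hw.le)
  have hk0 : 0 < |(k : ℝ)| := by positivity
  have h4 : ω * |(k : ℝ)| * E ≤ 2 / (η * ω) * wt (-1) k := by
    rw [div_mul_eq_mul_div, le_div_iff₀ (by positivity)]
    have h5 : η * (ω * |(k : ℝ)|) ^ 2 * E ≤ 1 := by rwa [mul_pow, sq_abs, ← mul_pow]
    have h6 : (ω * |(k : ℝ)| * E * (η * ω)) * |(k : ℝ)| ≤ (2 * wt (-1) k) * |(k : ℝ)| := by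
      linarith
    exact le_of_mul_le_mul_right h6 hk0
  calc |α| * (ω * |(k : ℝ)|) * E = |α| * (ω * |(k : ℝ)| * E) := by ring
    _ ≤ |α| * (2 / (η * ω) * wt (-1) k) := mul_le_mul_of_nonneg_left h4 (abs_nonneg _)
    _ = _ := by ring

theorem norm_truncCub_le (hs : 1 / 2 < s) (hR : 0 < R) {j : ℕ} (hsj : 1 < s + j) {x : SeqL2}
    {B : ℝ} (hx : ∀ k, ‖x k‖ ≤ B * wt (-j) k) (k : ℤ) :
    ‖truncCub hs hR x k‖ ≤
      B ^ 3 * (2 ^ (s + j) * (2 * ∑' k, wt (-(s + j)) k)) ^ 2 * wt (-j) k := by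
  have h1 : ∀ k, ‖unwt s x k‖ ≤ B * wt (-(s + j)) k := fun k => by
    rw [norm_unwt, neg_add, wt_add]
    have := mul_le_mul_of_nonneg_left (hx k) (wt_pos (-s) k).le
    linarith
  have h2 := norm_cub_le_wt hsj h1 k
  have hθ0 := retrFactor_nonneg hR x
  have hθ1 := pow_le_one₀ (n := 3) hθ0 (retrFactor_le_one hR x)
  rw [truncCub_apply, norm_mul, norm_pow, Complex.norm_real, Real.norm_of_nonneg hθ0, norm_mul,
    Complex.norm_real, Real.norm_of_nonneg (wt_pos _ _).le]
  refine (mul_le_of_le_one_left (by have := wt_pos s k; positivity) hθ1).trans ?_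
  refine (mul_le_mul_of_nonneg_left h2 (wt_pos s k).le).trans (le_of_eq ?_)
  rw [neg_add, wt_add]
  linear_combination (B ^ 3 * (2 ^ (s + j) * (2 * ∑' k, wt (-s + -j) k)) ^ 2 * wt (-j) k) *
    wt_mul_neg s k

/-- Bootstrap on the decay exponent. The cubic term preserves the decay already known on `[δ/2, T]`,
and the Duhamel integral over recent times adds one power. The earlier times, and the initial value,
are damped by a Gaussian factor in `k`. -/
theorem exists_decay (hω : 0 < ω) (hη : 0 < η)
    (hlam : ∀ k, (lam k).re = -(η * (ω * k) ^ 2))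
    (hc : ∀ k, c k = -(α : ℂ) * Complex.I * (ω * k : ℝ)) (hs : 1 / 2 < s) (hs1 : 1 < s)
    (hR : 0 < R) (ha : Continuous a)
    (hsol : ∀ t ∈ Icc 0 T, ∀ k, a t k = mild lam c a₀ (fun ξ => truncCub hs hR (a ξ)) t k)
    (j : ℕ) {δ : ℝ} (hδ : 0 < δ) :
    ∃ B : ℝ, 0 ≤ B ∧ ∀ t ∈ Icc δ T, ∀ k, ‖a t k‖ ≤ B * wt (-j) k := by
  induction j generalizing δ with
  | zero =>
    obtain ⟨B, hB⟩ := isCompact_Icc.exists_bound_of_continuousOn (s := Icc δ T) ha.continuousOn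
    refine ⟨max B 0, le_max_right _ _, fun t ht k => ?_⟩
    rw [Nat.cast_zero, neg_zero, wt_zero, mul_one]
    exact ((SeqL2.norm_apply_le _ _).trans (hB t ht)).trans (le_max_left _ _)
  | succ j ih =>
    obtain ⟨B, hB0, hB⟩ := ih (half_pos hδ)
    have hg : Continuous fun ξ => truncCub hs hR (a ξ) := (truncCub hs hR).continuous.comp ha
    obtain ⟨M, hM⟩ := isCompact_Icc.exists_bound_of_continuousOn (s := Icc 0 T) hg.continuousOn
    have hsj : 1 < s + j := by
      have : (0 : ℝ) ≤ j := Nat.cast_nonneg j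
      linarith
    have hN := fun ξ (hξ : ξ ∈ Icc (δ / 2) T) => norm_truncCub_le hs hR hsj (hB ξ hξ)
    set B' := B ^ 3 * (2 ^ (s + j) * (2 * ∑' k, wt (-(s + j)) k)) ^ 2 with hB'
    have hB'0 : 0 ≤ B' := by
      have : 0 ≤ ∑' k, wt (-(s + j)) k := tsum_nonneg fun k => (wt_pos _ k).le
      positivity
    -- The target exponent is `j + 1`; the additional 1 pays for the growth of `c k`.
    obtain ⟨E, hE0, hE⟩ := exists_exp_le_wt (ε := η * ω ^ 2 * (δ / 2)) (by positivity)
      ((j : ℝ) + 1 + 1)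
    -- The three summands bound the free evolution, the Duhamel integral over `[0, δ/2]`, and the
    -- Duhamel integral over `[δ/2, t]`.
    refine ⟨E * ‖a₀‖ + E * (|α| * ω * |M|) * (δ / 2) + B' * (|α| * 2 / (η * ω)), by positivity,
      fun t ht k => ?_⟩
    have ht0 : 0 ≤ t := hδ.le.trans ht.1
    have hre : (lam k).re ≤ 0 := by 
      rw [hlam, neg_nonpos]
      positivity
    have hexp : Real.exp ((lam k).re * (δ / 2)) ≤ E * wt (-((j : ℝ) + 1 + 1)) k := by
      refine le_trans (le_of_eq ?_) (hE k)
      rw [hlam]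
      congr 1
      ring
    have hw : wt (-((j : ℝ) + 1 + 1)) k = wt (-((j : ℝ) + 1)) k * wt (-1) k := by
      rw [neg_add, wt_add]
    have hw1 : wt (-((j : ℝ) + 1 + 1)) k ≤ wt (-((j : ℝ) + 1)) k := wt_mono (by linarith) k
    have hd := norm_duhamel_le (c := c) hg hre (half_pos hδ).le (by linarith [ht.1])
      (fun ξ hξ => (SeqL2.norm_apply_le _ k).trans
        ((hM ξ ⟨hξ.1, by linarith [hξ.2, ht.1, ht.2]⟩).trans (le_abs_self M)))
      (fun ξ hξ => hN ξ ⟨hξ.1, hξ.2.trans ht.2⟩ k)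
    rw [hsol t ⟨ht0, ht.2⟩ k, mild]
    push_cast
    refine (norm_add_le _ _).trans ?_
    have h1 : ‖Complex.exp (lam k * t) * a₀ k‖ ≤ E * ‖a₀‖ * wt (-((j : ℝ) + 1)) k := by
      rw [norm_mul, norm_exp_mul_real]
      have h2 : Real.exp ((lam k).re * t) ≤ Real.exp ((lam k).re * (δ / 2)) :=
        Real.exp_le_exp.mpr (mul_le_mul_of_nonpos_left (by linarith [ht.1]) hre)
      have h3 := h2.trans (hexp.trans (mul_le_mul_of_nonneg_left hw1 hE0))
      have := mul_le_mul h3 (SeqL2.norm_apply_le a₀ k) (norm_nonneg _)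
        (mul_nonneg hE0 (wt_pos _ _).le)
      linarith
    have h2 : Real.exp ((lam k).re * (δ / 2)) * (‖c k‖ * |M|) * (δ / 2) ≤
        E * (|α| * ω * |M|) * (δ / 2) * wt (-((j : ℝ) + 1)) k := by
      have h3 : ‖c k‖ ≤ |α| * ω * wt 1 k := by
        rw [norm_symbol_eq hω hc, mul_assoc]
        have := abs_le_wt_one k
        gcongr
      have h4 : Real.exp ((lam k).re * (δ / 2)) * ‖c k‖ ≤
          E * (|α| * ω) * wt (-((j : ℝ) + 1)) k := by
        refine (mul_le_mul hexp h3 (norm_nonneg _)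
          (mul_nonneg hE0 (wt_pos _ _).le)).trans (le_of_eq ?_)
        rw [hw]
        linear_combination (E * (|α| * ω) * wt (-((j : ℝ) + 1)) k) * wt_neg_mul 1 k
      have := mul_le_mul_of_nonneg_right h4 (by positivity : 0 ≤ |M| * (δ / 2))
      linarith
    have h3 : ‖c k‖ * (B' * wt (-j) k) * ∫ ξ in (0 : ℝ)..t, Real.exp ((lam k).re * (t - ξ)) ≤
        B' * (|α| * 2 / (η * ω)) * wt (-((j : ℝ) + 1)) k := by
      have h4 := mul_le_mul_of_nonneg_left (norm_symbol_mul_integral_le hω hη hlam hc k t)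
        (mul_nonneg hB'0 (wt_pos (-j) k).le)
      rw [neg_add, wt_add]
      linarith
    linarith

theorem hasDerivAt_apply (hs : 1 / 2 < s) (hR : 0 < R) (ha : Continuous a)
    (hsol : ∀ t ∈ Icc 0 T, ∀ k, a t k = mild lam c a₀ (fun ξ => truncCub hs hR (a ξ)) t k)
    {t : ℝ} (ht : t ∈ Ioo 0 T) (k : ℤ) :
    HasDerivAt (fun t => a t k) (lam k * a t k + c k * truncCub hs hR (a t) k) t := by
  have hg : Continuous fun ξ => truncCub hs hR (a ξ) := (truncCub hs hR).continuous.comp ha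
  have h1 := hasDerivAt_duhamel (lam := lam) (c := c) hg t k
  have h2 : HasDerivAt (fun t : ℝ => Complex.exp (lam k * t) * a₀ k)
      (Complex.exp (lam k * t) * (lam k * 1) * a₀ k) t :=
    (((hasDerivAt_id t).ofReal_comp.const_mul (lam k)).cexp).mul_const _
  have h3 : (fun t => a t k) =ᶠ[𝓝 t] fun t => Complex.exp (lam k * t) * a₀ k
      + duhamel lam c (fun ξ => truncCub hs hR (a ξ)) t k := by
    filter_upwards [Icc_mem_nhds ht.1 ht.2] with τ hτ
    exact hsol τ hτ k
  refine ((h2.add h1).congr_of_eventuallyEq h3).congr_deriv ?_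
  rw [h3.eq_of_nhds]
  ring

end

/-! ### The energy inequality and its integration -/

section
variable {lam c : ℤ → ℂ} {ω η α Λ s R T : ℝ} {a : ℝ → SeqL2} {a₀ : SeqL2}

theorem real_inner_symbol_cub (hc : ∀ k, c k = -(α : ℂ) * Complex.I * (ω * k : ℝ)) (hs : 1 / 2 < s)
    (hR : 0 < R) (x : SeqL2) (k : ℤ) :
    2 * inner ℝ (x k) (lam k * x k + c k * truncCub hs hR x k) =
      2 * (lam k).re * ‖x k‖ ^ 2 + 2 * α * ω * retrFactor R x ^ 3 *
        (osym s k * (cub (unwt s x) k * starRingEnd ℂ (unwt s x k)).im) := by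
  have e : x k = (wt s k : ℂ) * unwt s x k := (wt_mul_unwt s x k).symm
  rw [truncCub_apply, hc, Complex.inner, osym, ← wt_sq, ← Complex.normSq_eq_norm_sq]
  set z := unwt s x k
  set N := cub (unwt s x) k
  rw [e]
  have hθ : ((retrFactor R x : ℂ) ^ 3) = ((retrFactor R x ^ 3 : ℝ) : ℂ) := by push_cast; rfl
  rw [hθ]
  simp only [Complex.normSq_apply, map_mul, Complex.conj_ofReal, Complex.mul_re, Complex.mul_im,
    Complex.add_re, Complex.add_im, Complex.conj_re, Complex.conj_im, Complex.ofReal_re,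
    Complex.ofReal_im, Complex.neg_re, Complex.neg_im, Complex.I_re, Complex.I_im]
  ring

/-- Decay of the coefficients near `t` allows termwise differentiation; the quartic estimate then
applies to the nonlinear part. -/
theorem exists_hasDerivAt_norm_sq (hω : 0 < ω) (hη : 0 < η)
    (hlam : ∀ k, (lam k).re = -(η * (ω * k) ^ 2)) (hΛ : ∀ k, ‖lam k‖ ≤ Λ * wt 3 k)
    (hc : ∀ k, c k = -(α : ℂ) * Complex.I * (ω * k : ℝ)) (hs : 1 / 2 < s) (hs1 : 3 / 2 < s)
    (hR : 0 < R) (ha : Continuous a)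
    (hsol : ∀ t ∈ Icc 0 T, ∀ k, a t k = mild lam c a₀ (fun ξ => truncCub hs hR (a ξ)) t k)
    {t : ℝ} (ht : t ∈ Ioo 0 T) :
    ∃ y', HasDerivAt (fun t => ‖a t‖ ^ 2) y' t ∧
      y' ≤ 2 * |α| * ω * energyConst s * (‖a t‖ ^ 2) ^ 2 := by
  -- Enough decay to absorb the cubic growth of `lam` with a summable remainder `wt (-3)`, and to
  -- make `|osym s k| * ‖v k‖` summable, which requires `1 + 2s - (s + j) < -1`.
  obtain ⟨j, hj⟩ := exists_nat_gt (s + 3)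
  obtain ⟨B, hB0, hB⟩ := exists_decay hω hη hlam hc hs (by linarith) hR ha hsol j (half_pos ht.1)
  have hsj : 1 < s + j := by linarith
  have hN := fun ξ (hξ : ξ ∈ Icc (t / 2) T) => norm_truncCub_le hs hR hsj (hB ξ hξ)
  set B' := B ^ 3 * (2 ^ (s + j) * (2 * ∑' k, wt (-(s + j)) k)) ^ 2 with hB'
  have hB'0 : 0 ≤ B' := by
    have : 0 ≤ ∑' k, wt (-(s + j)) k := tsum_nonneg fun k => (wt_pos _ k).le
    positivity
  have hΛ0 : 0 ≤ Λ := nonneg_of_mul_nonneg_left ((norm_nonneg _).trans (hΛ 0)) (wt_pos _ _)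
  have hc3 : ∀ k, ‖c k‖ ≤ |α| * ω * wt 3 k := fun k => by
    rw [norm_symbol_eq hω hc, mul_assoc]
    have := (abs_le_wt_one k).trans (wt_mono (by norm_num : (1 : ℝ) ≤ 3) k)
    gcongr
  let f' : ℤ → ℝ → ℝ := fun k τ =>
    2 * inner ℝ (a τ k) (lam k * a τ k + c k * truncCub hs hR (a τ) k)
  have hder : ∀ k, ∀ τ ∈ Ioo (t / 2) T, HasDerivAt (fun τ => ‖a τ k‖ ^ 2) (f' k τ) τ :=
    fun k τ hτ => (hasDerivAt_apply hs hR ha hsol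
      ⟨(half_pos ht.1).trans hτ.1, hτ.2⟩ k).norm_sq
  have hbd : ∀ k, ∀ τ ∈ Ioo (t / 2) T, ‖f' k τ‖ ≤
      2 * B * (Λ * B + |α| * ω * B') * wt (-3) k := fun k τ hτ => by
    have hτ' : τ ∈ Icc (t / 2) T := ⟨hτ.1.le, hτ.2.le⟩
    have h1 := hB τ hτ' k
    have h2 := hN τ hτ' k
    have h3 := wt_pos (-j) k
    have h4 : ‖lam k * a τ k + c k * truncCub hs hR (a τ) k‖ ≤
        (Λ * B + |α| * ω * B') * (wt 3 k * wt (-j) k) := by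
      refine (norm_add_le _ _).trans ?_
      rw [norm_mul, norm_mul]
      have h5 := mul_le_mul (hΛ k) h1 (norm_nonneg _) (mul_nonneg hΛ0 (wt_pos _ _).le)
      have h6 := mul_le_mul (hc3 k) h2 (norm_nonneg _)
        (mul_nonneg (by positivity) (wt_pos _ _).le)
      linarith
    have h5 : wt (-j) k ≤ wt (-3) k := wt_mono (by linarith) k
    have h6 : wt 3 k * wt (-j) k ≤ 1 := by
      rw [← wt_mul_neg 3 k]
      exact mul_le_mul_of_nonneg_left h5 (wt_pos _ _).le
    have h7 : 0 ≤ Λ * B + |α| * ω * B' := by positivity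
    rw [norm_mul, Real.norm_of_nonneg zero_le_two, mul_assoc, mul_assoc, mul_assoc]
    refine mul_le_mul_of_nonneg_left ?_ zero_le_two
    refine (norm_inner_le_norm _ _).trans ?_
    refine (mul_le_mul (h1.trans (mul_le_mul_of_nonneg_left h5 hB0))
      (h4.trans (mul_le_of_le_one_right h7 h6)) (norm_nonneg _)
      (mul_nonneg hB0 (wt_pos _ _).le)).trans (le_of_eq ?_)
    ring
  have htm : t ∈ Ioo (t / 2) T := ⟨half_lt_self ht.1, ht.2⟩
  have hW : Summable fun k => 2 * B * (Λ * B + |α| * ω * B') * wt (-3) k :=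
    (summable_wt (by norm_num)).mul_left _
  have hmain := hasDerivAt_tsum_of_isPreconnected hW isOpen_Ioo isPreconnected_Ioo hder hbd htm
    (SeqL2.hasSum_sq (a t)).summable htm
  simp_rw [(SeqL2.hasSum_sq _).tsum_eq] at hmain
  refine ⟨_, hmain, ?_⟩
  have hf's : Summable fun k => f' k t := Summable.of_norm_bounded hW fun k => hbd k t htm
  set v := unwt s (a t) with hv
  have hvb : ∀ k, ‖v k‖ ≤ B * wt (-(s + j)) k := fun k => by
    rw [hv, norm_unwt, neg_add, wt_add]
    have := mul_le_mul_of_nonneg_left (hB t ⟨htm.1.le, htm.2.le⟩ k) (wt_pos (-s) k).le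
    linarith
  have hv1 : Summable fun k => ‖v k‖ :=
    ((summable_wt (r := -(s + j)) (by linarith)).mul_left B).of_nonneg_of_le
      (fun k => norm_nonneg _) hvb
  have hosym : ∀ k, |osym s k| ≤ wt (1 + 2 * s) k := fun k => by
    rw [osym, abs_mul, abs_of_pos (wt_pos _ _), wt_add]
    exact mul_le_mul_of_nonneg_right (abs_le_wt_one k) (wt_pos _ _).le
  have hv2 : Summable fun k => |osym s k| * ‖v k‖ := by
    refine ((summable_wt (r := 1 + 2 * s + -(s + j)) (by linarith)).mul_left B).of_nonneg_of_le
      (fun k => by positivity) fun k => ?_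
    rw [wt_add]
    have := mul_le_mul (hosym k) (hvb k) (norm_nonneg _) (wt_pos _ _).le
    linarith
  have hvs := hasSum_unwt s (a t)
  have hE := abs_tsum_osym_cub_le hs1 hv1 hv2 hvs.summable
  rw [hvs.tsum_eq] at hE
  have hes := (Complex.hasSum_im (hasSum_osym_cub hv1 hv2)).summable
  simp_rw [Complex.im_ofReal_mul] at hes
  set θ := retrFactor R (a t)
  have hθ0 : 0 ≤ θ := retrFactor_nonneg hR _
  have hθ1 : θ ^ 3 ≤ 1 := pow_le_one₀ hθ0 (retrFactor_le_one hR _)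
  -- The dissipative term is discarded by its sign, so `η` does not enter the constant.
  have hle : ∀ k, f' k t ≤ 2 * α * ω * θ ^ 3 *
      (osym s k * (cub v k * starRingEnd ℂ (v k)).im) := fun k => by
    simp only [f']
    rw [real_inner_symbol_cub hc]
    have : 2 * (lam k).re * ‖a t k‖ ^ 2 ≤ 0 := by
      rw [hlam]
      have : 0 ≤ 2 * (η * (ω * k) ^ 2) * ‖a t k‖ ^ 2 := by positivity
      linarith
    linarith
  refine (hf's.tsum_le_tsum hle (hes.mul_left _)).trans ?_
  rw [tsum_mul_left]
  refine (le_abs_self _).trans ?_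
  rw [abs_mul]
  have h8 : |2 * α * ω * θ ^ 3| ≤ 2 * |α| * ω := by
    rw [abs_mul, abs_mul, abs_mul, abs_of_pos hω, abs_two,
      abs_of_nonneg (by positivity : 0 ≤ θ ^ 3)]
    exact mul_le_of_le_one_right (by positivity) hθ1
  refine (mul_le_mul h8 hE (abs_nonneg _) (by positivity)).trans (le_of_eq ?_)
  ring

end

/-- The function `1 / y + K t` is nondecreasing. Since `y` may vanish, the argument is run for `y +
ε`, and `ε` tends to 0 after the denominators have been cleared. -/
theorem le_of_deriv_le_sq {y : ℝ → ℝ} {K T : ℝ} (hy : ContinuousOn y (Icc 0 T))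
    (hy0 : ∀ t, 0 ≤ y t) (hK : 0 ≤ K)
    (hd : ∀ t ∈ Ioo 0 T, ∃ y', HasDerivAt y y' t ∧ y' ≤ K * y t ^ 2) {t : ℝ} (ht : t ∈ Icc 0 T) :
    y t * (1 - K * t * y 0) ≤ y 0 := by
  have key : ∀ ε > 0, (y t + ε) * (1 - K * t * (y 0 + ε)) ≤ y 0 + ε := fun ε hε => by
    have hp : ∀ t, 0 < y t + ε := fun t => by linarith [hy0 t]
    have hmono : MonotoneOn (fun t => (y t + ε)⁻¹ + K * t) (Icc 0 T) := by
      have hderiv : ∀ x ∈ Ioo 0 T, ∃ z', HasDerivAt (fun t => (y t + ε)⁻¹ + K * t) z' x ∧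
          0 ≤ z' := fun x hx => by
        obtain ⟨y', h1, h2⟩ := hd x hx
        refine ⟨_, ((h1.add_const ε).fun_inv (hp x).ne').add ((hasDerivAt_id x).const_mul K), ?_⟩
        have h3 : y' / (y x + ε) ^ 2 ≤ K := by
          rw [div_le_iff₀ (by have := hp x; positivity)]
          refine h2.trans (mul_le_mul_of_nonneg_left ?_ hK)
          exact pow_le_pow_left₀ (hy0 x) (by linarith) 2
        rw [neg_div]
        linarith
      refine monotoneOn_of_deriv_nonneg (convex_Icc 0 T) ?_ ?_ ?_
      · exact ((hy.add continuousOn_const).inv₀ fun x _ => (hp x).ne').add (by fun_prop)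
      · rw [interior_Icc]
        intro x hx
        obtain ⟨z', h1, _⟩ := hderiv x hx
        exact h1.differentiableAt.differentiableWithinAt
      · rw [interior_Icc]
        intro x hx
        obtain ⟨z', h1, h2⟩ := hderiv x hx
        rwa [h1.deriv]
    have h1 := hmono ⟨le_rfl, ht.1.trans ht.2⟩ ht ht.1
    simp only [mul_zero, add_zero] at h1
    have h2 := mul_le_mul_of_nonneg_right h1 (mul_pos (hp t) (hp 0)).le
    have h3 : (y 0 + ε)⁻¹ * ((y t + ε) * (y 0 + ε)) = y t + ε := by
      have := (hp 0).ne'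
      field_simp
    have h4 : ((y t + ε)⁻¹ + K * t) * ((y t + ε) * (y 0 + ε)) =
        (y 0 + ε) + K * t * (y 0 + ε) * (y t + ε) := by
      have := (hp t).ne'
      field_simp
    rw [h3, h4] at h2
    linarith
  have hl : Tendsto (fun ε : ℝ => (y t + ε) * (1 - K * t * (y 0 + ε))) (𝓝[>] 0)
      (𝓝 ((y t + 0) * (1 - K * t * (y 0 + 0)))) := by
    refine (Continuous.tendsto ?_ 0).mono_left nhdsWithin_le_nhds
    fun_prop
  have hr : Tendsto (fun ε : ℝ => y 0 + ε) (𝓝[>] 0) (𝓝 (y 0 + 0)) := by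
    refine (Continuous.tendsto ?_ 0).mono_left nhdsWithin_le_nhds
    fun_prop
  have := le_of_tendsto_of_tendsto hl hr (by
    filter_upwards [self_mem_nhdsWithin] with ε hε using key ε hε)
  simpa using this

/-! ### From functions on the circle to coefficient sequences -/

theorem conv_comm (a b : ℤ → ℂ) (k : ℤ) : conv a b k = conv b a k := by
  unfold conv
  rw [← (Equiv.subLeft k).tsum_eq fun p => a p * b (k - p)]
  refine tsum_congr fun p => ?_
  simp [mul_comm]

section
variable {L : ℝ} [Fact (0 < L)]

/-- The `k`-th Fourier coefficient as a continuous linear functional. -/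
def coeffCLM (L : ℝ) [Fact (0 < L)] (k : ℤ) : L2per L →L[ℂ] ℂ :=
  (lp.evalCLM ℂ (fun _ : ℤ => ℂ) (p := 2) k).comp
    (fourierBasis (T := L)).repr.toContinuousLinearEquiv.toContinuousLinearMap

theorem coeffCLM_apply (k : ℤ) (f : L2per L) : coeffCLM L k f = fourierCoeff f k :=
  fourierBasis_repr f k

theorem fourierCoeff_toLp_eq (g : C(AddCircle L, ℂ)) (k : ℤ) :
    coeffCLM L k (ContinuousMap.toLp (E := ℂ) 2 AddCircle.haarAddCircle ℂ g) =
      fourierCoeff g k := by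
  rw [coeffCLM_apply, fourierCoeff_toLp]

theorem L2per_ext {f g : L2per L} (h : ∀ k, fourierCoeff f k = fourierCoeff g k) : f = g := by
  refine fourierBasis.repr.injective ?_
  ext k
  rw [fourierBasis_repr, fourierBasis_repr, h]

/-- A function with absolutely summable Fourier coefficients is continuous. -/
theorem exists_continuous_of_summable {f : L2per L} (hf : Summable fun k => ‖fourierCoeff f k‖) :
    ∃ g : C(AddCircle L, ℂ), f = ContinuousMap.toLp (E := ℂ) 2 AddCircle.haarAddCircle ℂ g := by
  have h : Summable fun k => fourierCoeff f k • (fourier k : C(AddCircle L, ℂ)) := by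
    refine Summable.of_norm ?_
    simp_rw [norm_smul, fourier_norm, mul_one]
    exact hf
  refine ⟨_, (hasSum_fourier_series_L2 f).unique
    (h.hasSum.mapL (ContinuousMap.toLp (E := ℂ) 2 AddCircle.haarAddCircle ℂ))⟩

theorem fourierCoeff_fourier_mul (h : C(AddCircle L, ℂ)) (p k : ℤ) :
    fourierCoeff (fourier p * h : C(AddCircle L, ℂ)) k = fourierCoeff h (k - p) := by
  unfold fourierCoeff
  congr 1
  funext x
  rw [ContinuousMap.mul_apply, smul_eq_mul, smul_eq_mul, ← mul_assoc, ← fourier_add]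
  congr 3
  ring

/-- The Fourier series of `g` converges uniformly, so it may be multiplied by `h` and the continuous
coefficient functional applied term by term. -/
theorem fourierCoeff_mul {g : C(AddCircle L, ℂ)} (hg : Summable fun k => ‖fourierCoeff g k‖)
    (h : C(AddCircle L, ℂ)) (k : ℤ) :
    fourierCoeff (g * h : C(AddCircle L, ℂ)) k = conv (fourierCoeff g) (fourierCoeff h) k := by
  have h1 := (hasSum_fourier_series_of_summable hg.of_norm).mul_right h
  have h2 := (h1.mapL (ContinuousMap.toLp (E := ℂ) 2 AddCircle.haarAddCircle ℂ)).mapL (coeffCLM L k)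
  simp_rw [fourierCoeff_toLp_eq] at h2
  rw [← h2.tsum_eq, conv]
  refine tsum_congr fun p => ?_
  rw [smul_mul_assoc, ContinuousMap.coe_smul, fourierCoeff.const_smul, fourierCoeff_fourier_mul,
    smul_eq_mul]

theorem fourierCoeff_star (g : C(AddCircle L, ℂ)) (k : ℤ) :
    fourierCoeff (star g : C(AddCircle L, ℂ)) k = refl (fourierCoeff g) k := by
  unfold fourierCoeff refl
  rw [← integral_conj]
  congr 1
  funext x
  rw [smul_eq_mul, smul_eq_mul, map_mul, ← fourier_neg]
  simp

/-- Summability provides a continuous representative `g`, for which the cubic term is the pointwise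
product of `g` with `g * star g`; in particular the default value in `cubic` does not occur. -/
theorem fourierCoeff_cubic {u : L2per L} (hu : Summable fun k => ‖fourierCoeff u k‖) (k : ℤ) :
    fourierCoeff (cubic u) k = cub (fourierCoeff u) k := by
  obtain ⟨g, rfl⟩ := exists_continuous_of_summable hu
  set u := ContinuousMap.toLp (E := ℂ) 2 AddCircle.haarAddCircle ℂ g
  have hug : u =ᵐ[AddCircle.haarAddCircle] g := ContinuousMap.coeFn_toLp _ g
  let q : C(AddCircle L, ℂ) := g * (g * star g)
  have hq : (fun x => ((‖u x‖ ^ 2 : ℝ) : ℂ) * u x) =ᵐ[AddCircle.haarAddCircle] q := by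
    filter_upwards [hug] with x hx
    rw [hx]
    change _ = g x * (g x * star (g x))
    rw [mul_comm]
    congr 1
    push_cast
    exact (Complex.mul_conj' (g x)).symm
  have hqm : MemLp q 2 (AddCircle.haarAddCircle (T := L)) :=
    (Lp.memLp (ContinuousMap.toLp (E := ℂ) 2 AddCircle.haarAddCircle ℂ q)).ae_eq
      (ContinuousMap.coeFn_toLp _ q)
  have hm := hqm.ae_eq hq.symm
  have hfg : fourierCoeff u = fourierCoeff g := funext fun k => fourierCoeff_toLp g k
  rw [hfg] at hu ⊢
  have h1 : fourierCoeff (cubic u) k = fourierCoeff q k := by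
    refine congrFun (fourierCoeff_congr_ae ?_) k
    rw [cubic, dif_pos hm]
    exact hm.coeFn_toLp.trans hq
  have h2 : (fourierCoeff (g * star g : C(AddCircle L, ℂ))) =
      conv (fourierCoeff g) (refl (fourierCoeff g)) := by
    funext k
    rw [fourierCoeff_mul hu]
    congr 1
    exact funext (fourierCoeff_star g)
  rw [h1, fourierCoeff_mul hu, h2, conv_comm, cub]

theorem wt_norm_sq_eq (s : ℝ) (f : L2per L) (k : ℤ) :
    (1 + (k : ℝ) ^ 2) ^ s * ‖fourierCoeff f k‖ ^ 2 = ‖(wt s k : ℂ) * fourierCoeff f k‖ ^ 2 := by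
  rw [norm_wt_mul_sq, wt_two_mul]

theorem memℓp_of_mem_Hper {s : ℝ} {f : L2per L} (hf : f ∈ Hper L s) :
    Memℓp (fun k : ℤ => (wt s k : ℂ) * fourierCoeff f k) 2 := by
  rw [memℓp_two_iff]
  simp_rw [← wt_norm_sq_eq]
  exact hf

open Classical in
/-- The weighted Fourier coefficients of a function in `H^s`. -/
def hcoef (s : ℝ) (f : L2per L) : SeqL2 :=
  if h : Memℓp (fun k : ℤ => (wt s k : ℂ) * fourierCoeff f k) 2 then ⟨_, h⟩ else 0

theorem hcoef_apply {s : ℝ} {f : L2per L} (hf : f ∈ Hper L s) (k : ℤ) :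
    hcoef s f k = (wt s k : ℂ) * fourierCoeff f k := by
  rw [hcoef, dif_pos (memℓp_of_mem_Hper hf)]

theorem unwt_hcoef {s : ℝ} {f : L2per L} (hf : f ∈ Hper L s) :
    unwt s (hcoef s f) = fourierCoeff f := by
  funext k
  rw [unwt, hcoef_apply hf]
  exact unwt_wt_mul s _ k

theorem fourierCoeff_sub (f g : L2per L) (k : ℤ) :
    fourierCoeff (f - g : L2per L) k = fourierCoeff f k - fourierCoeff g k := by
  rw [← coeffCLM_apply, map_sub, coeffCLM_apply, coeffCLM_apply]

theorem hnorm_sub_eq {s : ℝ} {f g : L2per L} (hf : f ∈ Hper L s) (hg : g ∈ Hper L s) :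
    hnorm s (f - g) = ‖hcoef s f - hcoef s g‖ := by
  rw [hnorm, ← Real.sqrt_sq (norm_nonneg (hcoef s f - hcoef s g)),
    ← (SeqL2.hasSum_sq (hcoef s f - hcoef s g)).tsum_eq]
  congr 1
  refine tsum_congr fun k => ?_
  rw [wt_norm_sq_eq, fourierCoeff_sub, lp.coeFn_sub, Pi.sub_apply, hcoef_apply hf,
    hcoef_apply hg, mul_sub]

theorem hnorm_eq {s : ℝ} {f : L2per L} (hf : f ∈ Hper L s) : hnorm s f = ‖hcoef s f‖ := by
  rw [hnorm, ← Real.sqrt_sq (norm_nonneg (hcoef s f)), ← (SeqL2.hasSum_sq (hcoef s f)).tsum_eq]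
  congr 1
  refine tsum_congr fun k => ?_
  rw [wt_norm_sq_eq, hcoef_apply hf]

theorem memℓp_unwt {s : ℝ} (hs : 0 ≤ s) (a : SeqL2) : Memℓp (unwt s a) 2 :=
  memℓp_two_iff.mpr (summable_sq_of_wt hs (hasSum_unwt s a).summable)

/-- The function in `H^s` with given weighted Fourier coefficients. -/
def ofCoef (L : ℝ) [Fact (0 < L)] {s : ℝ} (hs : 0 ≤ s) (a : SeqL2) : L2per L :=
  fourierBasis.repr.symm ⟨unwt s a, memℓp_unwt hs a⟩

theorem fourierCoeff_ofCoef {s : ℝ} (hs : 0 ≤ s) (a : SeqL2) (k : ℤ) :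
    fourierCoeff (ofCoef L hs a) k = unwt s a k := by
  rw [← fourierBasis_repr, ofCoef, LinearIsometryEquiv.apply_symm_apply]

theorem ofCoef_mem {s : ℝ} (hs : 0 ≤ s) (a : SeqL2) : ofCoef L hs a ∈ Hper L s := by
  change Summable _
  simp_rw [← wt_two_mul, fourierCoeff_ofCoef]
  exact (hasSum_unwt s a).summable

theorem hcoef_ofCoef {s : ℝ} (hs : 0 ≤ s) (a : SeqL2) : hcoef s (ofCoef L hs a) = a := by
  ext k
  rw [hcoef_apply (ofCoef_mem hs a), fourierCoeff_ofCoef, wt_mul_unwt]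

theorem summable_norm_fourierCoeff {s : ℝ} (hs : 3 / 2 < s) {f : L2per L} (hf : f ∈ Hper L s) :
    Summable fun k => ‖fourierCoeff f k‖ := by
  have h : Summable fun k => wt (2 * s) k * ‖fourierCoeff f k‖ ^ 2 := by
    simp_rw [wt_two_mul]
    exact hf
  exact (summable_weighted hs h).1.of_nonneg_of_le (fun k => norm_nonneg _) fun k =>
    le_mul_of_one_le_left (norm_nonneg _) (one_le_wt zero_le_one k)

/-- The symbol of `-α ∂_x`. -/
def symbolF (L α : ℝ) (k : ℤ) : ℂ := -(α : ℂ) * Complex.I * (2 * Real.pi / L * k : ℝ)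

theorem freq_eq (L : ℝ) (k : ℤ) : freq L k = 2 * Real.pi / L * k := by
  unfold freq
  ring

theorem freq_scale_pos (L : ℝ) [h : Fact (0 < L)] : 0 < 2 * Real.pi / L :=
  div_pos (by positivity) h.out

theorem norm_symbolF_sq_mul_le {α s : ℝ} (x : SeqL2) {M : ℝ} (hM : ‖x‖ ≤ M) (k : ℤ) :
    ‖symbolF L α k * unwt s x k‖ ^ 2 ≤
      (|α| * (2 * Real.pi / L)) ^ 2 * M ^ 2 * wt (-(2 * (s - 1))) k := by
  have h1 : ‖symbolF L α k‖ ≤ |α| * (2 * Real.pi / L) * wt 1 k := by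
    rw [norm_symbol_eq (c := symbolF L α) (freq_scale_pos L) (fun _ => rfl), mul_assoc]
    have := abs_le_wt_one k
    have := freq_scale_pos L
    gcongr
  have h2 : ‖unwt s x k‖ ≤ wt (-s) k * M := by
    rw [norm_unwt]
    exact mul_le_mul_of_nonneg_left ((SeqL2.norm_apply_le x k).trans hM) (wt_pos _ _).le
  rw [norm_mul]
  have h3 := mul_le_mul h1 h2 (norm_nonneg _)
    (mul_nonneg (mul_nonneg (abs_nonneg _) (freq_scale_pos L).le) (wt_pos _ _).le)
  refine (pow_le_pow_left₀ (by positivity) h3 2).trans (le_of_eq ?_)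
  rw [show -(2 * (s - 1)) = 2 * (1 + -s) by ring, ← wt_sq, wt_add]
  ring

theorem cub_fourierCoeff {s : ℝ} (hs : 1 / 2 < s) {f : L2per L} (hf : f ∈ Hper L s) :
    cub (fourierCoeff f) = unwt s (hcub hs (hcoef s f)) := by
  funext k
  rw [unwt, hcub_apply, unwt_hcoef hf]
  exact (unwt_wt_mul s _ k).symm

theorem fourierCoeff_nonlin {α s : ℝ} (hs : 1 / 2 < s) (hs1 : 3 / 2 < s) {f : L2per L}
    (hf : f ∈ Hper L s) (k : ℤ) :
    fourierCoeff (nonlin α f) k = symbolF L α k * unwt s (hcub hs (hcoef s f)) k := by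
  have h1 := fourierCoeff_cubic (summable_norm_fourierCoeff hs1 hf)
  rw [cub_fourierCoeff hs hf] at h1
  have h2 : Memℓp (fun k : ℤ => Complex.I * freq L k * fourierCoeff (cubic f) k) 2 := by
    rw [memℓp_two_iff]
    simp_rw [h1]
    refine ((summable_wt (r := -(2 * (s - 1))) (by linarith)).mul_left _).of_nonneg_of_le
      (fun k => by positivity)
      fun k => le_trans (le_of_eq ?_)
        (norm_symbolF_sq_mul_le (L := L) (α := 1) (hcub hs (hcoef s f)) le_rfl k)
    simp [symbolF, freq_eq]
  rw [nonlin, ← coeffCLM_apply, map_smul, coeffCLM_apply, dx, fourierCoeff_multiplier h2, h1,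
    symbolF, smul_eq_mul, freq_eq]
  ring

end

/-! ### Equivalence of the two integral equations, and uniqueness -/

theorem duhamel_congr {lam c : ℤ → ℂ} {g h : ℝ → SeqL2} {t : ℝ} (ht : 0 ≤ t)
    (hgh : ∀ ξ ∈ Icc 0 t, g ξ = h ξ) (k : ℤ) : duhamel lam c g t k = duhamel lam c h t k := by
  refine intervalIntegral.integral_congr fun ξ hξ => ?_
  rw [uIcc_of_le ht] at hξ
  simp only [hgh ξ hξ]

theorem mild_congr {lam c : ℤ → ℂ} {g h : ℝ → SeqL2} {t : ℝ} (ht : 0 ≤ t) (a₀ : SeqL2)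
    (hgh : ∀ ξ ∈ Icc 0 t, g ξ = h ξ) (k : ℤ) : mild lam c a₀ g t k = mild lam c a₀ h t k := by
  rw [mild, mild, duhamel_congr ht hgh]

theorem symbolA_re (L η β γ : ℝ) (k : ℤ) :
    (symbolA L η β γ k).re = -(η * (2 * Real.pi / L * k) ^ 2) := by
  rw [← freq_eq]
  simp [symbolA, pow_succ, Complex.mul_re, Complex.mul_im]

section
variable {L : ℝ} [Fact (0 < L)]

theorem norm_symbolA_le {η : ℝ} (hη : 0 ≤ η) (β γ : ℝ) (k : ℤ) :
    ‖symbolA L η β γ k‖ ≤ ((1 + η) * (2 * Real.pi / L) ^ 2 + |β| * (2 * Real.pi / L) ^ 3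
      + |γ| * (2 * Real.pi / L)) * wt 3 k := by
  set ω := 2 * Real.pi / L with hω
  have hω0 : 0 < ω := freq_scale_pos L
  have h0 : ‖(freq L k : ℂ)‖ ≤ ω * wt 1 k := by
    rw [Complex.norm_real, freq_eq, norm_mul, Real.norm_of_nonneg hω0.le]
    exact mul_le_mul_of_nonneg_left (abs_le_wt_one k) hω0.le
  have hw1 : 1 ≤ wt 1 k := one_le_wt zero_le_one k
  have h3 : wt 3 k = wt 1 k ^ 3 := by
    rw [show (3 : ℝ) = 1 + 1 + 1 by norm_num, wt_add, wt_add]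
    ring
  have h12 : wt 1 k ^ 2 ≤ wt 3 k := h3 ▸ pow_le_pow_right₀ hw1 (by norm_num)
  have h11 : wt 1 k ≤ wt 3 k := wt_mono (by norm_num) k
  set f : ℂ := (freq L k : ℂ)
  have p2 : ‖f‖ ^ 2 ≤ ω ^ 2 * wt 3 k := by
    refine (pow_le_pow_left₀ (norm_nonneg _) h0 2).trans ?_
    rw [mul_pow]
    gcongr
  have p3 : ‖f‖ ^ 3 ≤ ω ^ 3 * wt 3 k := by
    refine (pow_le_pow_left₀ (norm_nonneg _) h0 3).trans ?_
    rw [mul_pow, h3]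
  have p1 : ‖f‖ ≤ ω * wt 3 k := h0.trans (by gcongr)
  have e1 : ‖-Complex.I * f ^ 2‖ = ‖f‖ ^ 2 := by simp
  have e2 : ‖(η : ℂ) * f ^ 2‖ = η * ‖f‖ ^ 2 := by simp [abs_of_nonneg hη]
  have e3 : ‖(β : ℂ) * Complex.I * f ^ 3‖ = |β| * ‖f‖ ^ 3 := by simp
  have e4 : ‖Complex.I * (γ : ℂ) * f‖ = |γ| * ‖f‖ := by simp
  have t1 := norm_add_le (-Complex.I * f ^ 2 - η * f ^ 2 - β * Complex.I * f ^ 3)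
    (Complex.I * γ * f)
  have t2 := norm_sub_le (-Complex.I * f ^ 2 - η * f ^ 2) (β * Complex.I * f ^ 3)
  have t3 := norm_sub_le (-Complex.I * f ^ 2) ((η : ℂ) * f ^ 2)
  have q2 := mul_le_mul_of_nonneg_left p2 hη
  have q3 := mul_le_mul_of_nonneg_left p3 (abs_nonneg β)
  have q1 := mul_le_mul_of_nonneg_left p1 (abs_nonneg γ)
  unfold symbolA
  linarith

/-- Both sides are quadratic in the frequency, with ratio `α² / (2η)`. The added 1 keeps the
constant positive when `α = 0`. -/
theorem norm_symbolF_sq_le {η : ℝ} (hη : 0 < η) (α β γ : ℝ) (k : ℤ) :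
    ‖symbolF L α k‖ ^ 2 ≤ (α ^ 2 / (2 * η) + 1) * (-(2 * (symbolA L η β γ k).re)) := by
  rw [norm_symbol_eq (c := symbolF L α) (freq_scale_pos L) (fun _ => rfl), symbolA_re]
  have e : (|α| * (2 * Real.pi / L * |(k : ℝ)|)) ^ 2 = α ^ 2 * (2 * Real.pi / L * k) ^ 2 := by
    rw [mul_pow, mul_pow, sq_abs, sq_abs, mul_pow]
  rw [e]
  have h1 : 0 ≤ η * (2 * Real.pi / L * k) ^ 2 := by positivity
  have h2 : α ^ 2 / (2 * η) * (2 * (η * (2 * Real.pi / L * k) ^ 2)) =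
      α ^ 2 * (2 * Real.pi / L * k) ^ 2 := by
    field_simp
  linarith

/-- Fourier coefficients of the Bochner integral in the integral equation. -/
theorem wt_mul_coeff_integral {α β γ η s : ℝ} (hη : 0 ≤ η) (hs : 1 / 2 < s) (hs1 : 3 / 2 < s)
    {w : ℝ → L2per L} {t : ℝ} (ht : 0 ≤ t) (hw : ∀ ξ ∈ Icc 0 t, w ξ ∈ Hper L s)
    (hint : IntervalIntegrable (fun ξ => semigroup η β γ (t - ξ) (nonlin α (w ξ))) volume 0 t)
    (k : ℤ) :
    (wt s k : ℂ) * fourierCoeff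
      (∫ ξ in (0 : ℝ)..t, semigroup η β γ (t - ξ) (nonlin α (w ξ)) : L2per L) k =
    duhamel (symbolA L η β γ) (symbolF L α) (fun ξ => hcub hs (hcoef s (w ξ))) t k := by
  rw [← coeffCLM_apply, ← ContinuousLinearMap.intervalIntegral_comp_comm _ hint, duhamel,
    ← intervalIntegral.integral_const_mul]
  refine intervalIntegral.integral_congr fun ξ hξ => ?_
  rw [uIcc_of_le ht] at hξ
  simp only
  rw [coeffCLM_apply, fourierCoeff_semigroup hη (by linarith [hξ.2]),
    fourierCoeff_nonlin hs hs1 (hw ξ hξ)]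
  have := wt_mul_unwt s (hcub hs (hcoef s (w ξ))) k
  rw [← this]
  ring

theorem hcoef_eq_mild {α β γ η s T : ℝ} {u₀ : L2per L} {v : ℝ → L2per L} (hη : 0 ≤ η)
    (hs : 1 / 2 < s) (hs1 : 3 / 2 < s) (hu₀ : u₀ ∈ Hper L s) (hv : IsSolution α β γ η s u₀ T v)
    {t : ℝ} (ht : t ∈ Icc 0 T) (k : ℤ) :
    hcoef s (v t) k = mild (symbolA L η β γ) (symbolF L α) (hcoef s u₀)
      (fun ξ => hcub hs (hcoef s (v ξ))) t k := by
  have hmem : ∀ ξ ∈ Icc 0 t, v ξ ∈ Hper L s := fun ξ hξ => hv.cont.mem ξ ⟨hξ.1, hξ.2.trans ht.2⟩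
  rw [hcoef_apply (hv.cont.mem t ht), mild, hcoef_apply hu₀,
    ← wt_mul_coeff_integral hη hs hs1 ht.1 hmem (hv.integrable t ht)]
  conv_lhs => rw [hv.eq t ht]
  rw [← coeffCLM_apply, map_add, coeffCLM_apply, coeffCLM_apply, fourierCoeff_semigroup hη ht.1]
  ring

theorem ContInHper.continuous_restrict {s T : ℝ} {v : ℝ → L2per L} (hv : ContInHper s T v) :
    ContinuousOn (fun t => hcoef s (v t)) (Icc 0 T) := by
  intro t ht
  rw [ContinuousWithinAt, tendsto_iff_norm_sub_tendsto_zero]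
  refine (hv.tendsto t ht).congr' ?_
  filter_upwards [self_mem_nhdsWithin] with τ hτ
  exact hnorm_sub_eq (hv.mem τ hτ) (hv.mem t ht)

/-- Makes the Bochner integral meaningful. Each coefficient is continuous in time, and the squared
coefficients are dominated by a multiple of `wt (-(2 * (s - 1)))`, which is summable for `s > 3/2`.
-/
theorem continuousOn_semigroup_nonlin {α β γ η s : ℝ} (hη : 0 ≤ η) (hs : 1 / 2 < s)
    (hs1 : 3 / 2 < s) {w : ℝ → L2per L} {t : ℝ} (hw : ∀ ξ ∈ Icc 0 t, w ξ ∈ Hper L s)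
    (hc : ContinuousOn (fun ξ => hcub hs (hcoef s (w ξ))) (Icc 0 t)) :
    ContinuousOn (fun ξ => semigroup η β γ (t - ξ) (nonlin α (w ξ))) (Icc 0 t) := by
  obtain ⟨M, hM⟩ := isCompact_Icc.exists_bound_of_continuousOn hc
  have hcoeff : ∀ ξ ∈ Icc 0 t, ∀ k, fourierBasis.repr
      (semigroup η β γ (t - ξ) (nonlin α (w ξ))) k =
      Complex.exp (symbolA L η β γ k * (t - ξ : ℝ)) *
        (symbolF L α k * unwt s (hcub hs (hcoef s (w ξ))) k) := fun ξ hξ k => by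
    rw [fourierBasis_repr, fourierCoeff_semigroup hη (by linarith [hξ.2]),
      fourierCoeff_nonlin hs hs1 (hw ξ hξ)]
  have hbd : ∀ ξ ∈ Icc 0 t, ∀ k, ‖fourierBasis.repr
      (semigroup η β γ (t - ξ) (nonlin α (w ξ))) k‖ ^ 2 ≤
      (|α| * (2 * Real.pi / L)) ^ 2 * M ^ 2 * wt (-(2 * (s - 1))) k := fun ξ hξ k => by
    refine le_trans (pow_le_pow_left₀ (norm_nonneg _) ?_ 2)
      (norm_symbolF_sq_mul_le (hcub hs (hcoef s (w ξ))) (hM ξ hξ) k)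
    rw [hcoeff ξ hξ, norm_mul]
    exact mul_le_of_le_one_left (norm_nonneg _) (norm_exp_symbolA_le hη (by linarith [hξ.2]) k)
  have h1 : ContinuousOn (fun ξ => fourierBasis.repr
      (semigroup η β γ (t - ξ) (nonlin α (w ξ)))) (Icc 0 t) := fun ξ hξ => by
    refine SeqL2.tendsto_of_dominated
      ((summable_wt (r := -(2 * (s - 1))) (by linarith)).mul_left _) (fun k => ?_)
      (eventually_nhdsWithin_of_forall hbd) (hbd ξ hξ)
    have h2 : ContinuousOn (fun ξ => Complex.exp (symbolA L η β γ k * (t - ξ : ℝ)) *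
        (symbolF L α k * unwt s (hcub hs (hcoef s (w ξ))) k)) (Icc 0 t) := by
      have h3 := (SeqL2.continuous_apply k).comp_continuousOn hc
      simp only [Function.comp_def] at h3
      unfold unwt
      have h4 : Continuous fun ξ : ℝ => Complex.exp (symbolA L η β γ k * (t - ξ : ℝ)) := by
        fun_prop
      exact h4.continuousOn.mul (continuousOn_const.mul (continuousOn_const.mul h3))
    exact (h2.congr fun x hx => hcoeff x hx k) ξ hξ
  have h2 := (fourierBasis (T := L)).repr.symm.continuous.comp_continuousOn h1
  simpa [Function.comp_def] using h2

theorem isSolution_ofCoef {α β γ η s T : ℝ} {u₀ : L2per L} {a : ℝ → SeqL2} (hη : 0 ≤ η)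
    (hs : 1 / 2 < s) (hs0 : 0 ≤ s) (hs1 : 3 / 2 < s) (hu₀ : u₀ ∈ Hper L s) (ha : Continuous a)
    (hcub : ContinuousOn (fun ξ => hcub hs (a ξ)) (Icc 0 T))
    (hsol : ∀ t ∈ Icc 0 T, ∀ k, a t k = mild (symbolA L η β γ) (symbolF L α) (hcoef s u₀)
      (fun ξ => SchrodingerType.hcub hs (a ξ)) t k) :
    IsSolution α β γ η s u₀ T fun t => ofCoef L hs0 (a t) := by
  have hint : ∀ t ∈ Icc 0 T, IntervalIntegrable
      (fun ξ => semigroup η β γ (t - ξ) (nonlin α (ofCoef L hs0 (a ξ)))) volume 0 t :=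
    fun t ht => by
    refine ContinuousOn.intervalIntegrable ?_
    rw [uIcc_of_le ht.1]
    refine continuousOn_semigroup_nonlin hη hs hs1 (fun ξ _ => ofCoef_mem hs0 _) ?_
    simp_rw [hcoef_ofCoef]
    exact hcub.mono (Icc_subset_Icc_right ht.2)
  refine ⟨⟨fun t _ => ofCoef_mem hs0 _, fun t _ => ?_⟩, hint, fun t ht => ?_⟩
  · simp_rw [hnorm_sub_eq (ofCoef_mem hs0 _) (ofCoef_mem hs0 _), hcoef_ofCoef]
    exact (tendsto_iff_norm_sub_tendsto_zero.mp (ha.tendsto t)).mono_left nhdsWithin_le_nhds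
  · refine L2per_ext fun k => ?_
    have hk : (wt s k : ℂ) ≠ 0 := by
      exact_mod_cast (wt_pos s k).ne'
    refine mul_left_cancel₀ hk ?_
    rw [fourierCoeff_ofCoef, wt_mul_unwt, hsol t ht k, mild]
    conv_rhs => rw [← coeffCLM_apply, map_add, coeffCLM_apply, coeffCLM_apply]
    rw [mul_add, wt_mul_coeff_integral hη hs hs1 ht.1 (fun ξ _ => ofCoef_mem hs0 _) (hint t ht),
      fourierCoeff_semigroup hη ht.1, hcoef_apply hu₀]
    simp_rw [hcoef_ofCoef]
    ring

/-- Two continuous solutions of the integral equation in Fourier space coincide. -/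
theorem eqOn_of_mild {lam c : ℤ → ℂ} {κ s T : ℝ} {a₀ : SeqL2}
    (hκ : ∀ k, ‖c k‖ ^ 2 ≤ κ * (-(2 * (lam k).re))) (hκ0 : 0 < κ) (hs : 1 / 2 < s) (hT : 0 ≤ T)
    {a b : ℝ → SeqL2} (ha : ContinuousOn a (Icc 0 T)) (hb : ContinuousOn b (Icc 0 T))
    (hsa : ∀ t ∈ Icc 0 T, ∀ k, a t k = mild lam c a₀ (fun ξ => hcub hs (a ξ)) t k)
    (hsb : ∀ t ∈ Icc 0 T, ∀ k, b t k = mild lam c a₀ (fun ξ => hcub hs (b ξ)) t k) :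
    ∀ t ∈ Icc 0 T, a t = b t := by
  obtain ⟨M, hM⟩ := isCompact_Icc.exists_bound_of_continuousOn ha
  obtain ⟨N, hN⟩ := isCompact_Icc.exists_bound_of_continuousOn hb
  -- Both functions stay in the ball of this radius, hence both solve the same truncated equation,
  -- whose solution is unique.
  have hR : 0 < max 1 (max M N) := lt_max_of_lt_left one_pos
  obtain ⟨x, -, hx⟩ := existsUnique_mild hκ hκ0 hT (truncCub_sub_le hs hR) a₀
  have key : ∀ d : ℝ → SeqL2, ∀ hd : ContinuousOn d (Icc 0 T),
      (∀ t ∈ Icc 0 T, ‖d t‖ ≤ max 1 (max M N)) →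
      (∀ t ∈ Icc 0 T, ∀ k, d t k = mild lam c a₀ (fun ξ => hcub hs (d ξ)) t k) →
      (⟨(Icc 0 T).domRestrict d, hd.domRestrict⟩ : C(Icc 0 T, SeqL2)) = x := by
    intro d hd hdb hds
    refine hx _ fun t k => ?_
    refine (hds t t.2 k).trans (mild_congr t.2.1 a₀ (fun ξ hξ => ?_) k)
    have hξ' : ξ ∈ Icc 0 T := ⟨hξ.1, hξ.2.trans t.2.2⟩
    rw [IccExtend_of_mem hT _ hξ']
    exact (truncCub_of_le hs hR (hdb ξ hξ')).symm
  have h1 := key a ha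
    (fun t ht => (hM t ht).trans ((le_max_left _ _).trans (le_max_right _ _))) hsa
  have h2 := key b hb
    (fun t ht => (hN t ht).trans ((le_max_right _ _).trans (le_max_right _ _))) hsb
  intro t ht
  exact congrArg (fun f : C(Icc 0 T, SeqL2) => f ⟨t, ht⟩) (h1.trans h2.symm)

end

end SchrodingerType

end

/-! ### Assembly: removal of the truncation -/

open SchrodingerType in
theorem mainTheorem5 (L : ℝ) [Fact (0 < L)] (α β γ s : ℝ) (hs : 3 / 2 < s) :
    ∃ C : ℝ, 0 < C ∧
      ∀ (η : ℝ), 0 < η → ∀ u₀ ∈ Hper L s, ∀ T : ℝ, 0 < T → C * hnorm s u₀ ^ 2 * T < 2 →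
        ∃ u : ℝ → L2per L,
          IsSolution α β γ η s u₀ T u ∧
          (∀ (T₀ : ℝ) (v : ℝ → L2per L), IsSolution α β γ η s u₀ T₀ v →
            ∀ t ∈ Set.Icc 0 (min T₀ T), v t = u t) ∧
          (∀ t ∈ Set.Ioo 0 T,
            DifferentiableAt ℝ (fun τ => hnorm s (u τ) ^ 2) t ∧
            deriv (fun τ => hnorm s (u τ) ^ 2) t ≤ C * hnorm s (u t) ^ 4) ∧
          (∀ t ∈ Set.Icc 0 T,
            hnorm s (u t) ^ 2 ≤ 2 * hnorm s u₀ ^ 2 / (2 - C * t * hnorm s u₀ ^ 2)) := by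
  have hs2 : 1 / 2 < s := by linarith
  have hs0 : 0 ≤ s := by linarith
  have hE := energyConst_nonneg hs0
  have hω := freq_scale_pos L
  set K₀ := 2 * |α| * (2 * Real.pi / L) * energyConst s with hK₀
  have hK₀0 : 0 ≤ K₀ := by positivity
  -- The 1 makes the constant positive even if `α = 0`; the factor 2 matches the form of the stated
  -- bound, which is `y₀ / (1 - (K₀ + 1) t y₀)` with numerator and denominator doubled.
  refine ⟨2 * (K₀ + 1), by linarith, fun η hη u₀ hu₀ T hT hsmall => ?_⟩
  set y₀ := hnorm s u₀ ^ 2 with hy₀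
  have hy₀' : ‖hcoef s u₀‖ ^ 2 = y₀ := by rw [hy₀, hnorm_eq hu₀]
  have hy₀0 : 0 ≤ y₀ := sq_nonneg _
  set κ := α ^ 2 / (2 * η) + 1
  have hκ0 : 0 < κ := by positivity
  have hκ := norm_symbolF_sq_le (L := L) hη α β γ
  have hden : ∀ t ∈ Icc 0 T, 0 < 1 - (K₀ + 1) * t * y₀ := fun t ht => by
    have := mul_le_mul_of_nonneg_left ht.2 (by positivity : 0 ≤ (K₀ + 1) * y₀)
    linarith
  have hdT := hden T ⟨hT.le, le_rfl⟩
  -- The radius exceeds the a priori bound at time `T`, the largest on `[0, T]`. It can be fixed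
  -- beforehand because the energy constant of the truncated equation does not depend on it.
  set R := √(y₀ / (1 - (K₀ + 1) * T * y₀)) + 1
  have hR : 0 < R := by positivity
  obtain ⟨x, hx, -⟩ := existsUnique_mild hκ hκ0 hT.le (truncCub_sub_le hs2 hR) (hcoef s u₀)
  let a : ℝ → SeqL2 := IccExtend hT.le x
  have ha : Continuous a := x.continuous.Icc_extend'
  have hsolR : ∀ t ∈ Icc 0 T, ∀ k, a t k = mild (symbolA L η β γ) (symbolF L α) (hcoef s u₀)
      (fun ξ => truncCub hs2 hR (a ξ)) t k := fun t ht k => by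
    simp only [a]
    rw [IccExtend_of_mem hT.le _ ht]
    exact hx ⟨t, ht⟩ k
  have ha0 : a 0 = hcoef s u₀ := by
    ext k
    rw [hsolR 0 ⟨le_rfl, hT.le⟩ k]
    simp [mild, duhamel]
  have hder := fun t (ht : t ∈ Ioo 0 T) => exists_hasDerivAt_norm_sq hω hη
    (symbolA_re L η β γ) (norm_symbolA_le hη.le β γ) (fun _ => rfl) hs2 hs hR ha hsolR ht
  have hder' : ∀ t ∈ Ioo 0 T, ∃ y', HasDerivAt (fun t => ‖a t‖ ^ 2) y' t ∧
      y' ≤ (K₀ + 1) * (‖a t‖ ^ 2) ^ 2 := fun t ht => by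
    obtain ⟨y', h1, h2⟩ := hder t ht
    refine ⟨y', h1, h2.trans (mul_le_mul_of_nonneg_right (by linarith) (by positivity))⟩
  have hbound : ∀ t ∈ Icc 0 T, ‖a t‖ ^ 2 ≤ y₀ / (1 - (K₀ + 1) * t * y₀) := fun t ht => by
    have h1 := le_of_deriv_le_sq (ha.norm.pow 2).continuousOn (fun t => sq_nonneg _)
      (by linarith : 0 ≤ K₀ + 1) hder' ht
    change ‖a t‖ ^ 2 * (1 - (K₀ + 1) * t * ‖a 0‖ ^ 2) ≤ ‖a 0‖ ^ 2 at h1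
    rw [ha0, hy₀'] at h1
    rwa [le_div_iff₀ (hden t ht)]
  have haR : ∀ t ∈ Icc 0 T, ‖a t‖ ≤ R := fun t ht => by
    have h1 : y₀ / (1 - (K₀ + 1) * t * y₀) ≤ y₀ / (1 - (K₀ + 1) * T * y₀) := by
      refine div_le_div_of_nonneg_left hy₀0 hdT ?_
      have := mul_le_mul_of_nonneg_left ht.2 (by positivity : 0 ≤ (K₀ + 1) * y₀)
      linarith
    have h2 := Real.le_sqrt_of_sq_le ((hbound t ht).trans h1)
    linarith
  have hcubR : ∀ t ∈ Icc 0 T, truncCub hs2 hR (a t) = hcub hs2 (a t) := fun t ht =>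
    truncCub_of_le hs2 hR (haR t ht)
  have hsol : ∀ t ∈ Icc 0 T, ∀ k, a t k = mild (symbolA L η β γ) (symbolF L α) (hcoef s u₀)
      (fun ξ => hcub hs2 (a ξ)) t k := fun t ht k =>
    (hsolR t ht k).trans
      (mild_congr ht.1 _ (fun ξ hξ => hcubR ξ ⟨hξ.1, hξ.2.trans ht.2⟩) k)
  have hcont : ContinuousOn (fun ξ => hcub hs2 (a ξ)) (Icc 0 T) :=
    ((truncCub hs2 hR).continuous.comp ha).continuousOn.congr fun t ht => (hcubR t ht).symm
  have hnorm_u : ∀ t, hnorm s (ofCoef L hs0 (a t)) = ‖a t‖ := fun t => by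
    rw [hnorm_eq (ofCoef_mem hs0 _), hcoef_ofCoef]
  refine ⟨fun t => ofCoef L hs0 (a t),
    isSolution_ofCoef hη.le hs2 hs0 hs hu₀ ha hcont hsol, fun T₀ v hv t ht => ?_,
    fun t ht => ?_, fun t ht => ?_⟩
  · have hT' : 0 ≤ min T₀ T := ht.1.trans ht.2
    have hsub : Icc 0 (min T₀ T) ⊆ Icc 0 T₀ := Icc_subset_Icc_right (min_le_left _ _)
    have hsub' : Icc 0 (min T₀ T) ⊆ Icc 0 T := Icc_subset_Icc_right (min_le_right _ _)
    have h1 := eqOn_of_mild hκ hκ0 hs2 hT' (hv.cont.continuous_restrict.mono hsub)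
      ha.continuousOn
      (fun t ht k => hcoef_eq_mild hη.le hs2 hs hu₀ hv (hsub ht) k)
      (fun t ht k => hsol t (hsub' ht) k) t ht
    refine L2per_ext fun k => ?_
    rw [fourierCoeff_ofCoef, ← h1, unwt_hcoef (hv.cont.mem t (hsub ht))]
  · simp_rw [hnorm_u]
    obtain ⟨y', h1, h2⟩ := hder' t ht
    refine ⟨h1.differentiableAt, ?_⟩
    rw [h1.deriv]
    have : 0 ≤ (K₀ + 1) * ‖a t‖ ^ 4 := by positivity
    rw [← pow_mul, show 2 * 2 = 4 from rfl] at h2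
    linarith
  · rw [hnorm_u]
    refine (hbound t ht).trans (le_of_eq ?_)
    rw [div_eq_div_iff (hden t ht).ne' (by linarith [hden t ht])]
    ring
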